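/- **Setting.** Let $\mathcal G$ be a first-order $L$-structure and let $B\subset\mathcal G$ be a finite set of parameters. Let $G$ be a group acting by automorphisms on an abelian group $A$, where $G$, $A$ and the action are $\emptyset$-definable in $\mathcal G$. Let $h\colon G\times G\to A$ be a $2$-cocycle, i.e. $$h(x,y)+h(xy,z)=h(x,yz)+x\cdot h(y,z),\qquad h(x,e)=h(e,x)=0 \qquad (x,y,z\in G),$$ which is $B$-definable and whose image is finite and contained in $\operatorname{dcl}(B)$. Let $A_0\le A$ be the subgroup generated by the image of $h$. Let $\mathcal G^*\succ\mathcal G$ be a monster model: $\mathcal G^*$ is $\kappa$-saturated and strongly $\kappa$-homogeneous for an uncountable strong limit cardinal $\kappa>|L|$; "bounded" means "of cardinality $<\kappa$". A superscript $*$ denotes interpretation in $\mathcal G^*$. Let $\widetilde{G^*}=A^*\times G^*$ with the multiplication $$(a_1,g_1)(a_2,g_2)=(a_1+g_1\cdot a_2+h^*(g_1,g_2),\,g_1g_2).$$ For a group $X$ definable in $\mathcal G^*$ over $B$, let $X^{00}_B$ be the smallest subgroup of $X$ of bounded index that is type-definable over $B$, and $X^{000}_B$ the smallest subgroup of $X$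 of bounded index that is invariant under $\operatorname{Aut}(\mathcal G^*/B)$. Let $A^*_1$ be a bounded index subgroup of $A^*$ that is type-definable over $B$ and invariant under the action of $G^*$; write $A_0/A_1^*$ for the image of $A_0$ in $A^*/A^*_1$. **Hypotheses.** 1. $H\le G$ is a $B$-definable subgroup of finite index and $f\colon H\to A$ is a $B$-definable function with $f(e)=0$ and $h(x,y)=f(x)+x\cdot f(y)-f(xy)$ for all $x,y\in H$. 2. $A_0/(A^*_1\cap A_0)$ is torsion-free. Note that ${G^*}^{00}_B\subseteq H^*$, and let $\overline{f^*}\colon H^*\to A^*/A_1^*$ be the map induced by $f^*\colon H^*\to A^*$. **Statement.** Assume 1 and 2, and consider the condition $$(3)\qquad \overline{f^*}\left[{G^*}^{00}_B\right]\nsubseteq A_0/A^*_1 .$$ If (3) holds, then $\widetilde{G^*}^{000}_B\neq\widetilde{G^*}^{00}_B$. Moreover, (3) holds whenever at least one of the following two conditions is satisfied: * (4) $\overline{f^*}\left[{G^*}^{00}_B\right]$ contains a non-trivial subgroup of $A^*/A_1^*$; * (5) there is $a\in A\setminus A^*_1$ such that for every $B$-definable thick subset $P$ of $G$ there is $g\in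 P\cap H$ with $f(g^n)=na$ for all $n\in\mathbb Z$. Here a subset $P$ of $G$ is *thick* if $P=P^{-1}$ and there is $k\in\mathbb N$ such that for all $g_1,\dots,g_k\in G$ there are $1\le i<j\le k$ with $g_i^{-1}g_j\in P$. -/

import Mathlib

open FirstOrder FirstOrder.Language Cardinal

universe u v w w'

namespace ConnComp

/-! ### Interpretation of definable sets and maps in an elementary extension -/

section Interpretation

variable {L : FirstOrder.Language.{u, v}} {M : Type w'} [L.Structure M] {N : Type w} [L.Structure N]

/-- `P` and `Q` are the solution sets, in `M` and in its elementary extension `N`, of one and the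
same first-order formula with parameters from `M`. -/
def Linked (j : M ↪ₑ[L] N) {α : Type} (P : Set (α → M)) (Q : Set (α → N)) : Prop :=
  ∃ φ : L.Formula (M ⊕ α),
    P = {v | φ.Realize (Sum.elim id v)} ∧ Q = {x | φ.Realize (Sum.elim j x)}

/-- The interpretation in `N` of a set `P` definable in `M`: the set of solutions in `N` of any
formula (with parameters from `M`) that defines `P` in `M`. -/
def interp (j : M ↪ₑ[L] N) {α : Type} (P : Set (α → M)) : Set (α → N) :=
  {x | ∃ Q, Linked j P Q ∧ x ∈ Q}

/-- The graph of a map `t : X → Y`, where elements of `X` and `Y` are tuples of elements of `K` as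
recorded by the coordinate maps `c` and `d`. -/
def graph {K X Y α β : Type*} (c : X → α → K) (d : Y → β → K) (t : X → Y) : Set (α ⊕ β → K) :=
  {v | ∃ x, v = Sum.elim (c x) (d (t x))}

/-- Coordinates on a product. -/
def pairC {K X Y α β : Type*} (c : X → α → K) (d : Y → β → K) (p : X × Y) : α ⊕ β → K :=
  Sum.elim (c p.1) (d p.2)

variable {j : M ↪ₑ[L] N} {α β γ : Type}

theorem Linked.subset [Finite α] {P P' : Set (α → M)} {Q Q' : Set (α → N)}
    (h : Linked j P Q) (h' : Linked j P' Q') (hP : P ⊆ P') : Q ⊆ Q' := by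
  obtain ⟨φ, rfl, rfl⟩ := h
  obtain ⟨φ', rfl, rfl⟩ := h'
  have key := j.map_formula (Formula.iAlls α (φ.imp φ')) id
  rw [Formula.realize_iAlls, Formula.realize_iAlls] at key
  intro x hx
  have := key.2 (fun v => by
    rw [Formula.realize_imp]
    exact fun hv => hP hv) x
  rw [Formula.realize_imp] at this
  exact this hx

theorem Linked.eq_of_eq [Finite α] {P P' : Set (α → M)} {Q Q' : Set (α → N)}
    (h : Linked j P Q) (h' : Linked j P' Q') (hP : P = P') : Q = Q' :=
  (h.subset h' hP.subset).antisymm (h'.subset h hP.superset)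

theorem Linked.interp_eq [Finite α] {P : Set (α → M)} {Q : Set (α → N)} (h : Linked j P Q) :
    interp j P = Q := by
  ext x
  constructor
  · rintro ⟨Q', h', hx⟩
    rwa [h.eq_of_eq h' rfl]
  · exact fun hx => ⟨Q, h, hx⟩

theorem linked_interp [Finite α] {B : Set M} {P : Set (α → M)} (h : B.Definable L P) :
    Linked j P (interp j P) := by
  rw [Set.definable_iff_exists_formula_sum] at h
  obtain ⟨φ, hφ⟩ := h
  have h1 : Linked j P
      {x | (φ.relabel (Sum.map Subtype.val id) : L.Formula (M ⊕ α)).Realize (Sum.elim j x)} := by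
    refine ⟨φ.relabel (Sum.map Subtype.val id), ?_, rfl⟩
    rw [hφ]
    ext v
    simp only [Set.mem_ofPred_eq, Formula.realize_relabel]
    rw [Sum.elim_comp_map]
    rfl
  rw [h1.interp_eq]
  exact h1

theorem Linked.congr {P P' : Set (α → M)} {Q : Set (α → N)} (h : Linked j P Q) (hP : P = P') :
    Linked j P' Q := hP ▸ h

theorem Linked.relabel {P : Set (β → M)} {Q : Set (β → N)} (h : Linked j P Q) (ρ : β → α) :
    Linked j {v : α → M | v ∘ ρ ∈ P} {x : α → N | x ∘ ρ ∈ Q} := by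
  obtain ⟨φ, rfl, rfl⟩ := h
  refine ⟨φ.relabel (Sum.map id ρ), ?_, ?_⟩ <;> ext v <;>
    simp [Formula.realize_relabel, Sum.elim_comp_map]

theorem Linked.inter {P P' : Set (α → M)} {Q Q' : Set (α → N)}
    (h : Linked j P Q) (h' : Linked j P' Q') : Linked j (P ∩ P') (Q ∩ Q') := by
  obtain ⟨φ, rfl, rfl⟩ := h
  obtain ⟨φ', rfl, rfl⟩ := h'
  refine ⟨φ ⊓ φ', ?_, ?_⟩ <;> ext v <;> simp [Formula.realize_inf]

theorem Linked.ex [Finite β] {P : Set (α ⊕ β → M)} {Q : Set (α ⊕ β → N)} (h : Linked j P Q) :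
    Linked j {v : α → M | ∃ u, Sum.elim v u ∈ P} {x : α → N | ∃ u, Sum.elim x u ∈ Q} := by
  obtain ⟨φ, rfl, rfl⟩ := h
  refine ⟨Formula.iExs β (φ.relabel (Equiv.sumAssoc M α β).symm), ?_, ?_⟩ <;> ext v <;>
    simp only [Set.mem_ofPred_eq, Formula.realize_iExs, Formula.realize_relabel] <;>
    refine exists_congr fun u => iff_of_eq (congrArg _ ?_) <;> ext (a | a | a) <;> rfl

theorem linked_eqs [Finite β] (p q : β → M ⊕ α) :
    Linked j {v : α → M | ∀ b, Sum.elim id v (p b) = Sum.elim id v (q b)}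
      {x : α → N | ∀ b, Sum.elim j x (p b) = Sum.elim j x (q b)} := by
  refine ⟨Formula.iInf fun b => Term.equal (Term.var (p b)) (Term.var (q b)), ?_, ?_⟩ <;> ext v <;>
    simp [Formula.realize_iInf]

theorem mem_interp [Finite α] {P : Set (α → M)} {Q : Set (α → N)} (h : Linked j P Q) {v : α → M} :
    (fun i => j (v i)) ∈ Q ↔ v ∈ P := by
  obtain ⟨φ, rfl, rfl⟩ := h
  have := j.map_formula φ (Sum.elim id v)
  simp only [Set.mem_ofPred_eq, ← this]
  refine iff_of_eq (congrArg _ ?_)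
  ext (a | a) <;> rfl

section Maps

variable {X Y Z : Type*} {X' Y' Z' : Type*}
  {c : X → α → M} {c' : X' → α → N} {d : Y → β → M} {d' : Y' → β → N}
  {e : Z → γ → M} {e' : Z' → γ → N}

theorem graph_comp {K X Y Z α β γ : Type*} {c : X → α → K} {d : Y → β → K} {e : Z → γ → K}
    (hd : d.Injective) (t : X → Y) (s : Y → Z) :
    graph c e (s ∘ t) = {v | ∃ u : β → K,
      Sum.elim v u ∈ {z : (α ⊕ γ) ⊕ β → K |
        z ∘ (Sum.elim (Sum.inl ∘ Sum.inl) Sum.inr : α ⊕ β → (α ⊕ γ) ⊕ β) ∈ graph c d t} ∩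
        {z : (α ⊕ γ) ⊕ β → K |
        z ∘ (Sum.elim Sum.inr (Sum.inl ∘ Sum.inr) : β ⊕ γ → (α ⊕ γ) ⊕ β) ∈ graph d e s}} := by
  ext v
  constructor
  · rintro ⟨x, rfl⟩
    refine ⟨d (t x), ⟨x, ?_⟩, ⟨t x, ?_⟩⟩ <;> ext (a | a) <;> rfl
  · rintro ⟨u, ⟨x, hx⟩, ⟨y, hy⟩⟩
    have h1 : u = d (t x) := funext fun b => congrFun hx (Sum.inr b)
    have h2 : u = d y := funext fun b => congrFun hy (Sum.inl b)
    have h3 : y = t x := hd (h2.symm.trans h1)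
    subst h3
    refine ⟨x, ?_⟩
    ext (a | a)
    · exact congrFun hx (Sum.inl a)
    · exact congrFun hy (Sum.inr a)

theorem graph_pair {K X Y Z α β γ : Type*} {c : X → α → K} {d : Y → β → K} {e : Z → γ → K}
    (hc : c.Injective) (t : X → Y) (s : X → Z) :
    graph c (pairC d e) (fun x => (t x, s x)) =
      {z | z ∘ (Sum.map id Sum.inl : α ⊕ β → α ⊕ (β ⊕ γ)) ∈ graph c d t} ∩
      {z | z ∘ (Sum.map id Sum.inr : α ⊕ γ → α ⊕ (β ⊕ γ)) ∈ graph c e s} := by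
  ext v
  constructor
  · rintro ⟨x, rfl⟩
    refine ⟨⟨x, ?_⟩, ⟨x, ?_⟩⟩ <;> ext (a | a) <;> rfl
  · rintro ⟨⟨x, hx⟩, ⟨y, hy⟩⟩
    have h3 : x = y := hc (funext fun a =>
      (congrFun hx (Sum.inl a)).symm.trans (congrFun hy (Sum.inl a)))
    subst h3
    refine ⟨x, ?_⟩
    ext (a | a | a)
    · exact congrFun hx (Sum.inl a)
    · exact congrFun hx (Sum.inr a)
    · exact congrFun hy (Sum.inr a)

theorem range_pairC {K X Y α β : Type*} (c : X → α → K) (d : Y → β → K) :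
    Set.range (pairC c d) =
      {z | z ∘ Sum.inl ∈ Set.range c} ∩ {z | z ∘ Sum.inr ∈ Set.range d} := by
  ext v
  constructor
  · rintro ⟨p, rfl⟩
    exact ⟨⟨p.1, rfl⟩, ⟨p.2, rfl⟩⟩
  · rintro ⟨⟨x, hx⟩, ⟨y, hy⟩⟩
    refine ⟨(x, y), ?_⟩
    ext (a | a)
    · exact congrFun hx a
    · exact congrFun hy a

theorem pairC_injective {K X Y α β : Type*} {c : X → α → K} {d : Y → β → K}
    (hc : c.Injective) (hd : d.Injective) : (pairC c d).Injective := by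
  rintro ⟨x, y⟩ ⟨x', y'⟩ h
  have h1 : x = x' := hc (funext fun a => congrFun h (Sum.inl a))
  have h2 : y = y' := hd (funext fun a => congrFun h (Sum.inr a))
  rw [h1, h2]

theorem linked_range_pairC (hX : Linked j (Set.range c) (Set.range c'))
    (hY : Linked j (Set.range d) (Set.range d')) :
    Linked j (Set.range (pairC c d)) (Set.range (pairC c' d')) := by
  rw [range_pairC, range_pairC]
  exact (hX.relabel _).inter (hY.relabel _)

theorem linked_comp [Finite β] (hd : d.Injective) (hd' : d'.Injective)
    {t : X → Y} {t' : X' → Y'} {s : Y → Z} {s' : Y' → Z'}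
    (ht : Linked j (graph c d t) (graph c' d' t'))
    (hs : Linked j (graph d e s) (graph d' e' s')) :
    Linked j (graph c e (s ∘ t)) (graph c' e' (s' ∘ t')) := by
  rw [graph_comp hd, graph_comp hd']
  exact ((ht.relabel _).inter (hs.relabel _)).ex

theorem linked_pair (hc : c.Injective) (hc' : c'.Injective)
    {t : X → Y} {t' : X' → Y'} {s : X → Z} {s' : X' → Z'}
    (ht : Linked j (graph c d t) (graph c' d' t'))
    (hs : Linked j (graph c e s) (graph c' e' s')) :
    Linked j (graph c (pairC d e) fun x => (t x, s x))
      (graph c' (pairC d' e') fun x => (t' x, s' x)) := by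
  rw [graph_pair hc, graph_pair hc']
  exact (ht.relabel _).inter (hs.relabel _)

/-- A map that permutes or repeats coordinates. -/
theorem linked_proj [Finite β] (ρ : β → α) (hX : Linked j (Set.range c) (Set.range c'))
    {t : X → Y} {t' : X' → Y'} (ht : ∀ x, d (t x) = c x ∘ ρ) (ht' : ∀ x, d' (t' x) = c' x ∘ ρ) :
    Linked j (graph c d t) (graph c' d' t') := by
  have h := (hX.relabel (Sum.inl : α → α ⊕ β)).inter
    (linked_eqs (j := j) (fun b : β => Sum.inr (Sum.inr b : α ⊕ β)) fun b => Sum.inr (Sum.inl (ρ b)))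
  convert h using 1
  · ext v
    constructor
    · rintro ⟨x, rfl⟩
      exact ⟨⟨x, rfl⟩, fun b => congrFun (ht x) b⟩
    · rintro ⟨⟨x, hx⟩, h2⟩
      refine ⟨x, ?_⟩
      ext (a | a)
      · exact (congrFun hx a).symm
      · exact (h2 a).trans (((congrFun hx (ρ a)).symm).trans (congrFun (ht x) a).symm)
  · ext v
    constructor
    · rintro ⟨x, rfl⟩
      exact ⟨⟨x, rfl⟩, fun b => congrFun (ht' x) b⟩
    · rintro ⟨⟨x, hx⟩, h2⟩
      refine ⟨x, ?_⟩
      ext (a | a)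
      · exact (congrFun hx a).symm
      · exact (h2 a).trans (((congrFun hx (ρ a)).symm).trans (congrFun (ht' x) a).symm)

theorem linked_fst [Finite α] (hX : Linked j (Set.range c) (Set.range c'))
    (hY : Linked j (Set.range d) (Set.range d')) :
    Linked j (graph (pairC c d) c Prod.fst) (graph (pairC c' d') c' Prod.fst) :=
  linked_proj Sum.inl (linked_range_pairC hX hY) (fun _ => rfl) fun _ => rfl

theorem linked_snd [Finite β] (hX : Linked j (Set.range c) (Set.range c'))
    (hY : Linked j (Set.range d) (Set.range d')) :
    Linked j (graph (pairC c d) d Prod.snd) (graph (pairC c' d') d' Prod.snd) :=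
  linked_proj Sum.inr (linked_range_pairC hX hY) (fun _ => rfl) fun _ => rfl

theorem linked_p1 [Finite α] (hX : Linked j (Set.range c) (Set.range c'))
    (hY : Linked j (Set.range d) (Set.range d')) (hZ : Linked j (Set.range e) (Set.range e')) :
    Linked j (graph (pairC c (pairC d e)) c fun p => p.1)
      (graph (pairC c' (pairC d' e')) c' fun p => p.1) :=
  linked_proj Sum.inl (linked_range_pairC hX (linked_range_pairC hY hZ)) (fun _ => rfl) fun _ => rfl

theorem linked_p2 [Finite β] (hX : Linked j (Set.range c) (Set.range c'))
    (hY : Linked j (Set.range d) (Set.range d')) (hZ : Linked j (Set.range e) (Set.range e')) :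
    Linked j (graph (pairC c (pairC d e)) d fun p => p.2.1)
      (graph (pairC c' (pairC d' e')) d' fun p => p.2.1) :=
  linked_proj (Sum.inr ∘ Sum.inl) (linked_range_pairC hX (linked_range_pairC hY hZ))
    (fun _ => rfl) fun _ => rfl

theorem linked_p3 [Finite γ] (hX : Linked j (Set.range c) (Set.range c'))
    (hY : Linked j (Set.range d) (Set.range d')) (hZ : Linked j (Set.range e) (Set.range e')) :
    Linked j (graph (pairC c (pairC d e)) e fun p => p.2.2)
      (graph (pairC c' (pairC d' e')) e' fun p => p.2.2) :=
  linked_proj (Sum.inr ∘ Sum.inr) (linked_range_pairC hX (linked_range_pairC hY hZ))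
    (fun _ => rfl) fun _ => rfl

theorem linked_id [Finite α] (hX : Linked j (Set.range c) (Set.range c')) :
    Linked j (graph c c id) (graph c' c' id) :=
  linked_proj id hX (fun _ => rfl) fun _ => rfl

theorem linked_const [Finite β] (hX : Linked j (Set.range c) (Set.range c'))
    (y : Y) (y' : Y') (hy : ∀ b, d' y' b = j (d y b)) :
    Linked j (graph c d fun _ => y) (graph c' d' fun _ => y') := by
  have h := (hX.relabel (Sum.inl : α → α ⊕ β)).inter
    (linked_eqs (j := j) (fun b : β => Sum.inr (Sum.inr b : α ⊕ β)) fun b => Sum.inl (d y b))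
  convert h using 1
  · ext v
    constructor
    · rintro ⟨x, rfl⟩
      exact ⟨⟨x, rfl⟩, fun b => rfl⟩
    · rintro ⟨⟨x, hx⟩, h2⟩
      refine ⟨x, ?_⟩
      ext (a | a)
      · exact (congrFun hx a).symm
      · exact h2 a
  · ext v
    constructor
    · rintro ⟨x, rfl⟩
      exact ⟨⟨x, rfl⟩, fun b => hy b⟩
    · rintro ⟨⟨x, hx⟩, h2⟩
      refine ⟨x, ?_⟩
      ext (a | a)
      · exact (congrFun hx a).symm
      · exact (h2 a).trans (hy a).symm

theorem linked_map_unique [Finite α] [Finite β] (hc' : c'.Injective) (hd' : d'.Injective)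
    {t s : X → Y} {t' s' : X' → Y'}
    (ht : Linked j (graph c d t) (graph c' d' t'))
    (hs : Linked j (graph c d s) (graph c' d' s')) (h : ∀ x, t x = s x) (x' : X') :
    t' x' = s' x' := by
  have h' : graph c' d' t' = graph c' d' s' := ht.eq_of_eq hs (by rw [funext h])
  have hx : Sum.elim (c' x') (d' (t' x')) ∈ graph c' d' s' := h' ▸ ⟨x', rfl⟩
  obtain ⟨y, hy⟩ := hx
  have h1 : x' = y := hc' (funext fun a => congrFun hy (Sum.inl a))
  subst h1
  exact hd' (funext fun b => congrFun hy (Sum.inr b))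

theorem linked_map_exists [Finite α] [Finite β] (hc : c.Injective)
    (hX : Linked j (Set.range c) (Set.range c')) (hY : Linked j (Set.range d) (Set.range d'))
    {t : X → Y} {Q : Set (α ⊕ β → N)} (ht : Linked j (graph c d t) Q) :
    ∃ t' : X' → Y', Q = graph c' d' t' := by
  have h1 : ∀ x' : X', ∃ y' : Y', Sum.elim (c' x') (d' y') ∈ Q := by
    intro x'
    obtain ⟨u, hu⟩ := hX.subset ht.ex (by rintro _ ⟨x, rfl⟩; exact ⟨d (t x), x, rfl⟩) ⟨x', rfl⟩
    obtain ⟨y', hy'⟩ := ht.subset (hY.relabel Sum.inr) (by rintro _ ⟨x, rfl⟩; exact ⟨t x, rfl⟩) hu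
    refine ⟨y', ?_⟩
    rw [hy']
    exact hu
  choose t' ht' using h1
  refine ⟨t', Set.Subset.antisymm ?_ (by rintro _ ⟨x, rfl⟩; exact ht' x)⟩
  intro v hv
  obtain ⟨x', hx'⟩ := ht.subset (hX.relabel Sum.inl) (by rintro _ ⟨x, rfl⟩; exact ⟨x, rfl⟩) hv
  refine ⟨x', ?_⟩
  have h2 := ((ht.relabel (Sum.map id Sum.inl : α ⊕ β → α ⊕ (β ⊕ β))).inter
    (ht.relabel (Sum.map id Sum.inr : α ⊕ β → α ⊕ (β ⊕ β)))).subset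
    (linked_eqs (fun b => Sum.inr (Sum.inr (Sum.inl b))) fun b => Sum.inr (Sum.inr (Sum.inr b)))
    (by
      rintro z ⟨⟨x, hx⟩, ⟨y, hy⟩⟩ b
      have h3 : x = y := hc (funext fun a =>
        (congrFun hx (Sum.inl a)).symm.trans (congrFun hy (Sum.inl a)))
      subst h3
      exact (congrFun hx (Sum.inr b)).trans (congrFun hy (Sum.inr b)).symm)
  have h4 : ∀ b, v (Sum.inr b) = d' (t' x') b := by
    refine @h2 (Sum.elim (v ∘ Sum.inl) (Sum.elim (v ∘ Sum.inr) (d' (t' x')))) ⟨?_, ?_⟩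
    · have : v = Sum.elim (v ∘ Sum.inl) (Sum.elim (v ∘ Sum.inr) (d' (t' x'))) ∘
          (Sum.map id Sum.inl : α ⊕ β → α ⊕ (β ⊕ β)) := by ext (a | a) <;> rfl
      exact this ▸ hv
    · have : Sum.elim (c' x') (d' (t' x')) =
          Sum.elim (v ∘ Sum.inl) (Sum.elim (v ∘ Sum.inr) (d' (t' x'))) ∘
          (Sum.map id Sum.inr : α ⊕ β → α ⊕ (β ⊕ β)) := by
        ext (a | a)
        · exact congrFun hx' a
        · rfl
      rw [Set.mem_ofPred_eq, ← this]
      exact ht' x'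
  ext (a | a)
  · exact (congrFun hx' a).symm
  · exact h4 a

theorem linked_inverse_exists [Finite α] (hc : c.Injective) (hc' : c'.Injective)
    (hX : Linked j (Set.range c) (Set.range c')) {F : X × X → X} {F' : X' × X' → X'}
    (hF : Linked j (graph (pairC c c) c F) (graph (pairC c' c') c' F'))
    {e : X} {e' : X'} (he : ∀ a, c' e' a = j (c e a)) {iv : X → X}
    (hiv : ∀ x y, F (y, x) = e ↔ y = iv x) : ∃ iv' : X' → X', ∀ x', F' (iv' x', x') = e' := by
  have h1 : Linked j (graph c c iv) _ :=
    (((hF.inter (linked_eqs (fun a => Sum.inr (Sum.inr a)) fun a => Sum.inl (c e a))).ex).relabel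
      (Sum.swap : α ⊕ α → α ⊕ α)).congr (by
      ext v
      constructor
      · rintro ⟨u, ⟨⟨y, x⟩, h2⟩, h3⟩
        have hu : u = c (F (y, x)) := funext fun a => congrFun h2 (Sum.inr a)
        have h4 : F (y, x) = e := hc (hu.symm.trans (funext h3))
        refine ⟨x, ?_⟩
        rw [← (hiv x y).1 h4]
        ext (a | a)
        · exact congrFun h2 (Sum.inl (Sum.inr a))
        · exact congrFun h2 (Sum.inl (Sum.inl a))
      · rintro ⟨x, rfl⟩
        refine ⟨c e, ⟨⟨iv x, x⟩, ?_⟩, fun a => rfl⟩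
        rw [(hiv x (iv x)).2 rfl]
        ext ((a | a) | a) <;> rfl)
  obtain ⟨iv', h2⟩ := linked_map_exists hc hX hX h1
  rw [h2] at h1
  refine ⟨iv', fun x' => ?_⟩
  refine linked_map_unique hc' hc'
    (linked_comp (pairC_injective hc hc) (pairC_injective hc' hc')
      (linked_pair hc hc' h1 (linked_id hX)) hF) (linked_const hX e e' he) (fun x => ?_) x'
  exact (hiv x _).2 rfl

/-- The interpretation in `N` of a map `t : X → Y` definable in `M`: the map `X' → Y'` between the
interpretations of `X` and `Y` whose graph is the interpretation of the graph of `t`. -/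
noncomputable def interpMap [Finite α] [Finite β] (hc : c.Injective)
    (hX : Linked j (Set.range c) (Set.range c')) (hY : Linked j (Set.range d) (Set.range d'))
    (t : X → Y) {B : Set M} (ht : B.Definable L (graph c d t)) : X' → Y' :=
  Classical.choose (linked_map_exists hc hX hY (linked_interp ht (j := j)))

theorem graph_interpMap [Finite α] [Finite β] (hc : c.Injective)
    (hX : Linked j (Set.range c) (Set.range c')) (hY : Linked j (Set.range d) (Set.range d'))
    (t : X → Y) {B : Set M} (ht : B.Definable L (graph c d t)) :
    interp j (graph c d t) = graph c' d' (interpMap hc hX hY t ht) :=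
  Classical.choose_spec (linked_map_exists hc hX hY (linked_interp ht (j := j)))

theorem linked_interpMap [Finite α] [Finite β] (hc : c.Injective)
    (hX : Linked j (Set.range c) (Set.range c')) (hY : Linked j (Set.range d) (Set.range d'))
    (t : X → Y) {B : Set M} (ht : B.Definable L (graph c d t)) :
    Linked j (graph c d t) (graph c' d' (interpMap hc hX hY t ht)) := by
  rw [← graph_interpMap]
  exact linked_interp ht

end Maps

end Interpretation

/-! ### Extensions given by definable 2-cocycles -/

/-- A group `G` acting by automorphisms on an abelian group `A`, where `G`, `A` and the action are
`∅`-definable in the structure `M`, together with a `2`-cocycle `h : G × G → A` that is definable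
over `B` and has finite image contained in the definable closure of `B`. -/
structure CocycleData (L : FirstOrder.Language.{u, v}) (M : Type w') [L.Structure M]
    (B : Set M) where
  n : ℕ
  m : ℕ
  G : Set (Fin n → M)
  A : Set (Fin m → M)
  [group : Group G]
  [addCommGroup : AddCommGroup A]
  [action : DistribMulAction G A]
  definable_G : (∅ : Set M).Definable L G
  definable_A : (∅ : Set M).Definable L A
  definable_mul : (∅ : Set M).Definable L
    (graph (pairC Subtype.val Subtype.val) Subtype.val fun p : G × G => p.1 * p.2)
  definable_add : (∅ : Set M).Definable L
    (graph (pairC Subtype.val Subtype.val) Subtype.val fun p : A × A => p.1 + p.2)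
  definable_smul : (∅ : Set M).Definable L
    (graph (pairC Subtype.val Subtype.val) Subtype.val fun p : G × A => p.1 • p.2)
  /-- the cocycle -/
  h : G × G → A
  cocycle : ∀ x y z : G, h (x, y) + h (x * y, z) = h (x, y * z) + x • h (y, z)
  h_one_right : ∀ x : G, h (x, 1) = 0
  h_one_left : ∀ x : G, h (1, x) = 0
  definable_h : B.Definable L (graph (pairC Subtype.val Subtype.val) Subtype.val h)
  finite_h : (Set.range h).Finite
  h_mem_dcl : ∀ p, B.Definable L ({(h p : Fin m → M)} : Set (Fin m → M))

namespace CocycleData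

attribute [instance] CocycleData.group CocycleData.addCommGroup CocycleData.action

variable {L : FirstOrder.Language.{u, v}} {M : Type w'} [L.Structure M] {N : Type w} [L.Structure N]
  {B : Set M} (S : CocycleData L M B) (j : M ↪ₑ[L] N)

/-- The interpretation `G*` of `G` in `N`. -/
def GStar : Type w := {x : Fin S.n → N // x ∈ interp j S.G}

/-- The interpretation `A*` of `A` in `N`. -/
def AStar : Type w := {x : Fin S.m → N // x ∈ interp j S.A}

variable {j}

/-- Coordinates of an element of `G*`. -/
def gc (x : S.GStar j) : Fin S.n → N := x.1

/-- Coordinates of an element of `A*`. -/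
def ac (x : S.AStar j) : Fin S.m → N := x.1

theorem gc_injective : Function.Injective (S.gc (j := j)) := Subtype.val_injective

theorem ac_injective : Function.Injective (S.ac (j := j)) := Subtype.val_injective

theorem linked_G : Linked j (Set.range (Subtype.val : S.G → _)) (Set.range (S.gc (j := j))) := by
  have h : Set.range (S.gc (j := j)) = interp j S.G := Subtype.range_val
  rw [h, Subtype.range_val]
  exact linked_interp S.definable_G

theorem linked_A : Linked j (Set.range (Subtype.val : S.A → _)) (Set.range (S.ac (j := j))) := by
  have h : Set.range (S.ac (j := j)) = interp j S.A := Subtype.range_val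
  rw [h, Subtype.range_val]
  exact linked_interp S.definable_A

variable (j)

/-- The inclusion `G → G*`. -/
def incG (g : S.G) : S.GStar j :=
  ⟨fun i => j (g.1 i), (mem_interp (linked_interp S.definable_G)).2 g.2⟩

/-- The inclusion `A → A*` as a map of sets. -/
def incAFun (a : S.A) : S.AStar j :=
  ⟨fun i => j (a.1 i), (mem_interp (linked_interp S.definable_A)).2 a.2⟩

/-- The multiplication of `G*`. -/
noncomputable def mulStar : S.GStar j × S.GStar j → S.GStar j :=
  interpMap (pairC_injective Subtype.val_injective Subtype.val_injective)
    (linked_range_pairC S.linked_G S.linked_G) S.linked_G _ S.definable_mul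

/-- The addition of `A*`. -/
noncomputable def addStar : S.AStar j × S.AStar j → S.AStar j :=
  interpMap (pairC_injective Subtype.val_injective Subtype.val_injective)
    (linked_range_pairC S.linked_A S.linked_A) S.linked_A _ S.definable_add

/-- The action of `G*` on `A*`. -/
noncomputable def smulStar : S.GStar j × S.AStar j → S.AStar j :=
  interpMap (pairC_injective Subtype.val_injective Subtype.val_injective)
    (linked_range_pairC S.linked_G S.linked_A) S.linked_A _ S.definable_smul

/-- The interpretation `h*` of the cocycle `h`. -/
noncomputable def hStar : S.GStar j × S.GStar j → S.AStar j :=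
  interpMap (pairC_injective Subtype.val_injective Subtype.val_injective)
    (linked_range_pairC S.linked_G S.linked_G) S.linked_A _ S.definable_h

variable {j}

section Transfer

variable {X X' : Type*} {α : Type} {c : X → α → M} {c' : X' → α → N}

theorem linked_mulStar (hc : c.Injective) (hc' : c'.Injective)
    {t s : X → S.G} {t' s' : X' → S.GStar j}
    (ht : Linked j (graph c Subtype.val t) (graph c' S.gc t'))
    (hs : Linked j (graph c Subtype.val s) (graph c' S.gc s')) :
    Linked j (graph c Subtype.val fun x => t x * s x)
      (graph c' S.gc fun x => S.mulStar j (t' x, s' x)) :=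
  linked_comp (pairC_injective Subtype.val_injective Subtype.val_injective)
    (pairC_injective S.gc_injective S.gc_injective) (linked_pair hc hc' ht hs)
    (linked_interpMap _ _ _ _ S.definable_mul)

theorem linked_addStar (hc : c.Injective) (hc' : c'.Injective)
    {t s : X → S.A} {t' s' : X' → S.AStar j}
    (ht : Linked j (graph c Subtype.val t) (graph c' S.ac t'))
    (hs : Linked j (graph c Subtype.val s) (graph c' S.ac s')) :
    Linked j (graph c Subtype.val fun x => t x + s x)
      (graph c' S.ac fun x => S.addStar j (t' x, s' x)) :=
  linked_comp (pairC_injective Subtype.val_injective Subtype.val_injective)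
    (pairC_injective S.ac_injective S.ac_injective) (linked_pair hc hc' ht hs)
    (linked_interpMap _ _ _ _ S.definable_add)

theorem linked_smulStar (hc : c.Injective) (hc' : c'.Injective)
    {t : X → S.G} {s : X → S.A} {t' : X' → S.GStar j} {s' : X' → S.AStar j}
    (ht : Linked j (graph c Subtype.val t) (graph c' S.gc t'))
    (hs : Linked j (graph c Subtype.val s) (graph c' S.ac s')) :
    Linked j (graph c Subtype.val fun x => t x • s x)
      (graph c' S.ac fun x => S.smulStar j (t' x, s' x)) :=
  linked_comp (pairC_injective Subtype.val_injective Subtype.val_injective)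
    (pairC_injective S.gc_injective S.ac_injective) (linked_pair hc hc' ht hs)
    (linked_interpMap _ _ _ _ S.definable_smul)

theorem linked_hStar (hc : c.Injective) (hc' : c'.Injective)
    {t s : X → S.G} {t' s' : X' → S.GStar j}
    (ht : Linked j (graph c Subtype.val t) (graph c' S.gc t'))
    (hs : Linked j (graph c Subtype.val s) (graph c' S.gc s')) :
    Linked j (graph c Subtype.val fun x => S.h (t x, s x))
      (graph c' S.ac fun x => S.hStar j (t' x, s' x)) :=
  linked_comp (pairC_injective Subtype.val_injective Subtype.val_injective)
    (pairC_injective S.gc_injective S.gc_injective) (linked_pair hc hc' ht hs)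
    (linked_interpMap _ _ _ _ S.definable_h)

end Transfer

theorem mulStar_assoc (x y z : S.GStar j) :
    S.mulStar j (S.mulStar j (x, y), z) = S.mulStar j (x, S.mulStar j (y, z)) := by
  have k := S.linked_G (j := j)
  have i := pairC_injective (Subtype.val_injective (p := (· ∈ S.G)))
    (pairC_injective (Subtype.val_injective (p := (· ∈ S.G)))
      (Subtype.val_injective (p := (· ∈ S.G))))
  have i' := pairC_injective (S.gc_injective (j := j))
    (pairC_injective (S.gc_injective (j := j)) (S.gc_injective (j := j)))
  have p1 := linked_p1 k k k
  have p2 := linked_p2 k k k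
  have p3 := linked_p3 k k k
  exact linked_map_unique i' S.gc_injective
    (S.linked_mulStar i i' (S.linked_mulStar i i' p1 p2) p3)
    (S.linked_mulStar i i' p1 (S.linked_mulStar i i' p2 p3)) (fun p => mul_assoc _ _ _) (x, (y, z))

theorem mulStar_one_left (x : S.GStar j) : S.mulStar j (S.incG j 1, x) = x :=
  linked_map_unique S.gc_injective S.gc_injective
    (S.linked_mulStar Subtype.val_injective S.gc_injective
      (linked_const S.linked_G 1 (S.incG j 1) fun _ => rfl) (linked_id S.linked_G))
    (linked_id S.linked_G) (fun p => one_mul p) x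

theorem mulStar_inv_exists :
    ∃ iv : S.GStar j → S.GStar j, ∀ x, S.mulStar j (iv x, x) = S.incG j 1 :=
  linked_inverse_exists Subtype.val_injective S.gc_injective S.linked_G
    (linked_interpMap _ _ _ _ S.definable_mul) (e := 1) (fun _ => rfl) (iv := fun x => x⁻¹)
    fun _ _ => mul_eq_one_iff_eq_inv

/-- The group structure on `G*`. -/
noncomputable instance : Group (S.GStar j) :=
  letI : Mul (S.GStar j) := ⟨fun x y => S.mulStar j (x, y)⟩
  letI : One (S.GStar j) := ⟨S.incG j 1⟩
  letI : Inv (S.GStar j) := ⟨Classical.choose (S.mulStar_inv_exists (j := j))⟩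
  Group.ofLeftAxioms S.mulStar_assoc S.mulStar_one_left
    (Classical.choose_spec (S.mulStar_inv_exists (j := j)))

theorem addStar_assoc (x y z : S.AStar j) :
    S.addStar j (S.addStar j (x, y), z) = S.addStar j (x, S.addStar j (y, z)) := by
  have k := S.linked_A (j := j)
  have i := pairC_injective (Subtype.val_injective (p := (· ∈ S.A)))
    (pairC_injective (Subtype.val_injective (p := (· ∈ S.A)))
      (Subtype.val_injective (p := (· ∈ S.A))))
  have i' := pairC_injective (S.ac_injective (j := j))
    (pairC_injective (S.ac_injective (j := j)) (S.ac_injective (j := j)))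
  have p1 := linked_p1 k k k
  have p2 := linked_p2 k k k
  have p3 := linked_p3 k k k
  exact linked_map_unique i' S.ac_injective
    (S.linked_addStar i i' (S.linked_addStar i i' p1 p2) p3)
    (S.linked_addStar i i' p1 (S.linked_addStar i i' p2 p3)) (fun p => add_assoc _ _ _) (x, (y, z))

theorem addStar_comm (x y : S.AStar j) : S.addStar j (x, y) = S.addStar j (y, x) := by
  have k := S.linked_A (j := j)
  have i := pairC_injective (Subtype.val_injective (p := (· ∈ S.A)))
    (Subtype.val_injective (p := (· ∈ S.A)))
  have i' := pairC_injective (S.ac_injective (j := j)) (S.ac_injective (j := j))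
  exact linked_map_unique i' S.ac_injective
    (S.linked_addStar i i' (linked_fst k k) (linked_snd k k))
    (S.linked_addStar i i' (linked_snd k k) (linked_fst k k)) (fun p => add_comm _ _) (x, y)

theorem addStar_zero_left (x : S.AStar j) : S.addStar j (S.incAFun j 0, x) = x :=
  linked_map_unique S.ac_injective S.ac_injective
    (S.linked_addStar Subtype.val_injective S.ac_injective
      (linked_const S.linked_A 0 (S.incAFun j 0) fun _ => rfl) (linked_id S.linked_A))
    (linked_id S.linked_A) (fun p => zero_add p) x

theorem addStar_neg_exists :
    ∃ iv : S.AStar j → S.AStar j, ∀ x, S.addStar j (iv x, x) = S.incAFun j 0 :=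
  linked_inverse_exists Subtype.val_injective S.ac_injective S.linked_A
    (linked_interpMap _ _ _ _ S.definable_add) (e := 0) (fun _ => rfl) (iv := fun x => -x)
    fun _ _ => add_eq_zero_iff_eq_neg

/-- The abelian group structure on `A*`. -/
noncomputable instance : AddCommGroup (S.AStar j) :=
  letI : Add (S.AStar j) := ⟨fun x y => S.addStar j (x, y)⟩
  letI : Zero (S.AStar j) := ⟨S.incAFun j 0⟩
  letI : Neg (S.AStar j) := ⟨Classical.choose (S.addStar_neg_exists (j := j))⟩
  { AddGroup.ofLeftAxioms S.addStar_assoc S.addStar_zero_left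
      (Classical.choose_spec (S.addStar_neg_exists (j := j))) with
    add_comm := S.addStar_comm }

theorem smulStar_one (a : S.AStar j) : S.smulStar j (S.incG j 1, a) = a :=
  linked_map_unique S.ac_injective S.ac_injective
    (S.linked_smulStar Subtype.val_injective S.ac_injective
      (linked_const S.linked_A 1 (S.incG j 1) fun _ => rfl) (linked_id S.linked_A))
    (linked_id S.linked_A) (fun p => one_smul _ p) a

theorem smulStar_mul (x y : S.GStar j) (a : S.AStar j) :
    S.smulStar j (S.mulStar j (x, y), a) = S.smulStar j (x, S.smulStar j (y, a)) := by
  have k := S.linked_G (j := j)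
  have l := S.linked_A (j := j)
  have i := pairC_injective (Subtype.val_injective (p := (· ∈ S.G)))
    (pairC_injective (Subtype.val_injective (p := (· ∈ S.G)))
      (Subtype.val_injective (p := (· ∈ S.A))))
  have i' := pairC_injective (S.gc_injective (j := j))
    (pairC_injective (S.gc_injective (j := j)) (S.ac_injective (j := j)))
  have p1 := linked_p1 k k l
  have p2 := linked_p2 k k l
  have p3 := linked_p3 k k l
  exact linked_map_unique i' S.ac_injective
    (S.linked_smulStar i i' (S.linked_mulStar i i' p1 p2) p3)
    (S.linked_smulStar i i' p1 (S.linked_smulStar i i' p2 p3)) (fun p => mul_smul _ _ _) (x, (y, a))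

theorem smulStar_add (x : S.GStar j) (a b : S.AStar j) :
    S.smulStar j (x, a + b) = S.smulStar j (x, a) + S.smulStar j (x, b) := by
  have k := S.linked_G (j := j)
  have l := S.linked_A (j := j)
  have i := pairC_injective (Subtype.val_injective (p := (· ∈ S.G)))
    (pairC_injective (Subtype.val_injective (p := (· ∈ S.A)))
      (Subtype.val_injective (p := (· ∈ S.A))))
  have i' := pairC_injective (S.gc_injective (j := j))
    (pairC_injective (S.ac_injective (j := j)) (S.ac_injective (j := j)))
  have p1 := linked_p1 k l l
  have p2 := linked_p2 k l l
  have p3 := linked_p3 k l l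
  exact linked_map_unique i' S.ac_injective
    (S.linked_smulStar i i' p1 (S.linked_addStar i i' p2 p3))
    (S.linked_addStar i i' (S.linked_smulStar i i' p1 p2) (S.linked_smulStar i i' p1 p3))
    (fun p => smul_add _ _ _) (x, (a, b))

/-- The action of `G*` on `A*` by automorphisms. -/
noncomputable instance : DistribMulAction (S.GStar j) (S.AStar j) where
  smul x a := S.smulStar j (x, a)
  one_smul := S.smulStar_one
  mul_smul := S.smulStar_mul
  smul_add := S.smulStar_add
  smul_zero x := by
    have h := S.smulStar_add x 0 0
    rw [add_zero] at h
    exact left_eq_add.1 h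

theorem hStar_cocycle (x y z : S.GStar j) :
    S.hStar j (x, y) + S.hStar j (x * y, z) = S.hStar j (x, y * z) + x • S.hStar j (y, z) := by
  have k := S.linked_G (j := j)
  have i := pairC_injective (Subtype.val_injective (p := (· ∈ S.G)))
    (pairC_injective (Subtype.val_injective (p := (· ∈ S.G)))
      (Subtype.val_injective (p := (· ∈ S.G))))
  have i' := pairC_injective (S.gc_injective (j := j))
    (pairC_injective (S.gc_injective (j := j)) (S.gc_injective (j := j)))
  have p1 := linked_p1 k k k
  have p2 := linked_p2 k k k
  have p3 := linked_p3 k k k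
  exact linked_map_unique i' S.ac_injective
    (S.linked_addStar i i' (S.linked_hStar i i' p1 p2)
      (S.linked_hStar i i' (S.linked_mulStar i i' p1 p2) p3))
    (S.linked_addStar i i' (S.linked_hStar i i' p1 (S.linked_mulStar i i' p2 p3))
      (S.linked_smulStar i i' p1 (S.linked_hStar i i' p2 p3)))
    (fun p => S.cocycle _ _ _) (x, (y, z))

theorem hStar_one_left (x : S.GStar j) : S.hStar j (1, x) = 0 :=
  linked_map_unique S.gc_injective S.ac_injective
    (S.linked_hStar Subtype.val_injective S.gc_injective
      (linked_const S.linked_G 1 (S.incG j 1) fun _ => rfl) (linked_id S.linked_G))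
    (linked_const S.linked_G 0 (S.incAFun j 0) fun _ => rfl) (fun p => S.h_one_left p) x

variable (j)

/-- The inclusion `A → A*`. -/
noncomputable def incA : S.A →+ S.AStar j where
  toFun := S.incAFun j
  map_zero' := rfl
  map_add' a b := by
    have k : Linked j (Set.range (Subtype.val : S.A → _)) (Set.range (S.ac (j := j))) := S.linked_A
    exact linked_map_unique S.ac_injective S.ac_injective
      (linked_const k (a + b) (S.incAFun j (a + b)) fun _ => rfl)
      (S.linked_addStar Subtype.val_injective S.ac_injective
        (linked_const k a (S.incAFun j a) fun _ => rfl)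
        (linked_const k b (S.incAFun j b) fun _ => rfl)) (fun _ => rfl) (S.incAFun j 0)

/-- The subgroup `A₀` of `A` generated by the image of `h`. -/
def A0 : AddSubgroup S.A := AddSubgroup.closure (Set.range S.h)

/-- `A₀` as a subgroup of `A*`. -/
noncomputable def A0Star : AddSubgroup (S.AStar j) := S.A0.map (S.incA j)

/-- The set `A* × G*` underlying the extension of `G*` by `A*` given by `h*`. -/
@[ext] structure Ext where
  a : S.AStar j
  g : S.GStar j

variable {j}

/-- Coordinates of an element of the extension. -/
def ec (x : S.Ext j) : Fin S.m ⊕ Fin S.n → N := Sum.elim (S.ac x.a) (S.gc x.g)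

/-- The group structure of the extension:
`(a₁, g₁) * (a₂, g₂) = (a₁ + g₁ • a₂ + h*(g₁, g₂), g₁ g₂)`. -/
noncomputable instance : Group (S.Ext j) :=
  letI : Mul (S.Ext j) := ⟨fun x y => ⟨x.a + x.g • y.a + S.hStar j (x.g, y.g), x.g * y.g⟩⟩
  letI : One (S.Ext j) := ⟨⟨0, 1⟩⟩
  letI : Inv (S.Ext j) := ⟨fun x => ⟨-(x.g⁻¹ • x.a) - S.hStar j (x.g⁻¹, x.g), x.g⁻¹⟩⟩
  Group.ofLeftAxioms
    (fun x y z => Ext.ext (by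
      change x.a + x.g • y.a + S.hStar j (x.g, y.g) + (x.g * y.g) • z.a +
        S.hStar j (x.g * y.g, z.g) = x.a + x.g • (y.a + y.g • z.a + S.hStar j (y.g, z.g)) +
        S.hStar j (x.g, y.g * z.g)
      have h := S.hStar_cocycle x.g y.g z.g
      rw [smul_add, smul_add, ← mul_smul]
      calc _ = x.a + x.g • y.a + (x.g * y.g) • z.a +
            (S.hStar j (x.g, y.g) + S.hStar j (x.g * y.g, z.g)) := by abel
        _ = _ := by rw [h]; abel) (mul_assoc _ _ _))
    (fun x => Ext.ext (by
      change 0 + (1 : S.GStar j) • x.a + S.hStar j (1, x.g) = x.a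
      rw [one_smul, S.hStar_one_left, zero_add, add_zero]) (one_mul _))
    (fun x => Ext.ext (by
      change -(x.g⁻¹ • x.a) - S.hStar j (x.g⁻¹, x.g) + x.g⁻¹ • x.a + S.hStar j (x.g⁻¹, x.g) = 0
      abel) (inv_mul_cancel _))

end CocycleData

/-! ### Monster models and connected components -/

/-- `N` is a monster model (of degree of saturation `κ`): it is `κ`-saturated and strongly `κ`-homogeneous,
where `κ` is an uncountable strong limit cardinal larger than the cardinality of the language.
Sets and indices of size less than `κ` are called small, respectively bounded. -/
structure IsMonster (L : FirstOrder.Language.{u, v}) (N : Type w) [L.Structure N]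
    (κ : Cardinal.{w}) : Prop where
  aleph0_lt : ℵ₀ < κ
  isStrongLimit : κ.IsStrongLimit
  card_lt : Cardinal.lift.{w} L.card < Cardinal.lift.{max u v} κ
  /-- Every family of subsets of `N ^ k` definable over a small set `P` of parameters that has the
  finite intersection property has a common point. -/
  saturated : ∀ (P : Set N), #P < κ → ∀ (k : ℕ) (F : Set (Set (Fin k → N))),
    (∀ D ∈ F, P.Definable L D) → (∀ F₀ ⊆ F, F₀.Finite → (⋂₀ F₀).Nonempty) → (⋂₀ F).Nonempty
  /-- Every elementary map defined on a small subset extends to an automorphism. -/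
  homogeneous : ∀ (P : Set N), #P < κ → ∀ t : P → N,
    (∀ (k : ℕ) (φ : L.Formula (Fin k)) (x : Fin k → P),
      φ.Realize (fun i => t (x i)) ↔ φ.Realize fun i => (x i : N)) →
    ∃ σ : N ≃[L] N, ∀ p : P, σ p = t p

section Components

variable (L : FirstOrder.Language.{u, v}) {N : Type w} [L.Structure N] (B : Set N)

/-- `D` is type-definable over `B`: an intersection of `B`-definable sets. -/
def TypeDefinable {α : Type} (D : Set (α → N)) : Prop :=
  ∃ F : Set (Set (α → N)), (∀ E ∈ F, B.Definable L E) ∧ D = ⋂₀ F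

/-- `D` is invariant under all automorphisms of `N` that fix `B` pointwise. -/
def InvariantOver {α : Type} (D : Set (α → N)) : Prop :=
  ∀ σ : N ≃[L] N, (∀ b ∈ B, σ b = b) → ∀ x ∈ D, (fun i => σ (x i)) ∈ D

variable (κ : Cardinal.{w}) {X : Type w} [Group X] {α : Type} (c : X → α → N)

/-- `X^{00}_B`: the smallest subgroup of bounded index (less than `κ`) of the group `X` that is
type-definable over `B`. The elements of `X` are tuples from `N`, as recorded by `c`. -/
def comp00 : Subgroup X :=
  sInf {K | TypeDefinable L B (c '' (K : Set X)) ∧ #(X ⧸ K) < κ}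

/-- `X^{000}_B`: the smallest subgroup of bounded index (less than `κ`) of the group `X` that is
invariant over `B`. -/
def comp000 : Subgroup X :=
  sInf {K | InvariantOver L B (c '' (K : Set X)) ∧ #(X ⧸ K) < κ}

end Components

/-- A subset `P` of a group is thick if it is symmetric and, for some `k`, among any `k` elements
`g₁, …, g_k` of the group there are two, `g_p` and `g_q` with `p < q`, such that
`g_p⁻¹ g_q ∈ P`. -/
def IsThick {X : Type*} [Group X] (P : Set X) : Prop :=
  P⁻¹ = P ∧ ∃ k : ℕ, ∀ g : Fin k → X, ∃ p q : Fin k, p < q ∧ (g p)⁻¹ * g q ∈ P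

namespace CocycleData

variable {L : FirstOrder.Language.{u, v}} {M : Type w'} [L.Structure M] {N : Type w} [L.Structure N]
  {B : Set M} (S : CocycleData L M B) (j : M ↪ₑ[L] N)

/-- The coordinates of an element of a subgroup of `G`. -/
def subC (H : Subgroup S.G) (x : H) : Fin S.n → M := (x : S.G).1

/-- The image of `(G*)^{00}_B` in `A* / A₁` under the map induced by the interpretation of
`f : H → A` in `N`. -/
noncomputable def image00 (κ : Cardinal.{w}) (A₁ : AddSubgroup (S.AStar j)) (H : Subgroup S.G)
    (f : H → S.A) : Set (S.AStar j ⧸ A₁) :=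
  {q | ∃ g ∈ comp00 L (j '' B) κ (S.gc (j := j)), ∃ a : S.AStar j,
    Sum.elim (S.gc g) (S.ac a) ∈ interp j (graph (S.subC H) Subtype.val f) ∧
    q = QuotientAddGroup.mk a}

end CocycleData

end ConnComp

/-! On `H` the cocycle is the coboundary of `f`, so `x ↦ (-f*(x), x)` is a homomorphism from `H*` to
the extension with definable image (`sectionGroup`). If `K` is a type-definable subgroup of bounded
index in the extension, the projection to `G*` of its intersection with this image is again
type-definable of bounded index, so it contains the `00`-component of `G*`. Hence `(-f*(g), g)` lies
in the `00`-component of the extension for every `g` in that of `G*`. On the other hand, the `(a,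
g)` with `a ∈ A₀ + A₁` and `g` acting trivially on `A₀` modulo `A₁` form a subgroup of bounded index
(`trivSubgroup`), invariant because automorphisms over `B` fix `A₀` pointwise. If the two components
of the extension coincide, every such `f*(g)` therefore lies in `A₀ + A₁`
(`image00_subset_of_comp000_eq_comp00`).

Each of the two sufficient conditions yields some `a ∉ A₁` all of whose multiples `m • a`, `m ∈ ℕ`,
have their class in the image of the `00`-component. Suppose that this image is contained in
`A₀/A₁`. Its preimage `F` in `A*` is type-definable and lies in `A₀ + A₁`, and `(A₀ + A₁)/A₁` is
finitely generated and torsion-free, so only `0` is divisible there by all powers of a given `n ≥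
2`. Saturation provides `x ∈ F` that is an `n`-adic limit of the sums `(1 + n + ⋯ + n^(k-1)) • a`;
modulo `A₁` this forces `(n - 1) • x = -a`. Taking `n = 3^r + 1` makes `a` divisible by `3^r` for
every `r`, whence `a ∈ A₁`, a contradiction (`mem_of_forall_nsmul_mem`).

For the condition on thick sets, an element `g` of the `00`-component with `f*(g^m) = m • a` for all
`m` is found by compactness: a definable set containing a type-definable subgroup of bounded index
contains a definable thick set (`exists_thick_subset`), whose trace on `G` is thick, so finitely
many of the requirements on `g` are already met in `G`. -/

namespace ConnComp

/-! ### Definability of graphs, images and preimages in coordinates. -/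

section DefinableMaps

variable {L : FirstOrder.Language.{u, v}} {K : Type w} [L.Structure K] {P P' : Set K}
  {α β γ : Type}

theorem definable_ex [Finite β] {D : Set (α ⊕ β → K)} (h : P.Definable L D) :
    P.Definable L {v : α → K | ∃ u, Sum.elim v u ∈ D} := by
  have := Set.Definable.exists_of_finite (L := L) h
  exact this

theorem definable_eq (a b : α) : P.Definable L {v : α → K | v a = v b} :=
  ⟨Term.equal (Term.var a) (Term.var b), by ext v; simp⟩

theorem definable_eq_const (a : α) {p : K} (hp : p ∈ P) : P.Definable L {v : α → K | v a = p} :=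
  ⟨Term.equal (Term.var a) (Constants.term (L.con (⟨p, hp⟩ : P))), by ext v; simp⟩

theorem definable_singleton [Finite α] {x : α → K} (hx : ∀ a, x a ∈ P) :
    P.Definable L ({x} : Set (α → K)) := by
  have : ({x} : Set (α → K)) = ⋂ a, {v | v a = x a} := by
    ext v
    simp [funext_iff]
  rw [this]
  exact Set.definable_iInter_of_finite fun a => definable_eq_const a (hx a)

variable {X Y Z : Type*} {c : X → α → K} {d : Y → β → K} {e : Z → γ → K}

theorem graph_eq_image (t : X → Y) : graph c d t = pairC c d '' {p | t p.1 = p.2} := by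
  ext v
  constructor
  · rintro ⟨x, rfl⟩
    exact ⟨(x, t x), rfl, rfl⟩
  · rintro ⟨⟨x, y⟩, h, rfl⟩
    exact ⟨x, by rw [h]; rfl⟩

theorem graph_coord (ρ : β → α) {t : X → Y} (ht : ∀ x, d (t x) = c x ∘ ρ) :
    graph c d t = {v | v ∘ Sum.inl ∈ Set.range c} ∩ ⋂ b, {v | v (Sum.inr b) = v (Sum.inl (ρ b))} := by
  ext v
  constructor
  · rintro ⟨x, rfl⟩
    exact ⟨⟨x, rfl⟩, Set.mem_iInter.2 fun b => congrFun (ht x) b⟩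
  · rintro ⟨⟨x, hx⟩, h2⟩
    refine ⟨x, ?_⟩
    ext (a | a)
    · exact (congrFun hx a).symm
    · exact ((Set.mem_iInter.1 h2 a)).trans
        (((congrFun hx (ρ a)).symm).trans (congrFun (ht x) a).symm)

theorem definable_graph_coord [Finite β] (ρ : β → α) (hX : P.Definable L (Set.range c)) {t : X → Y}
    (ht : ∀ x, d (t x) = c x ∘ ρ) : P.Definable L (graph c d t) := by
  rw [graph_coord ρ ht]
  exact (hX.preimage_comp _).inter (Set.definable_iInter_of_finite fun b => definable_eq _ _)

theorem definable_graph_const [Finite β] (hX : P.Definable L (Set.range c)) {y : Y}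
    (hy : P.Definable L ({d y} : Set (β → K))) : P.Definable L (graph c d fun _ => y) := by
  have : graph c d (fun _ => y) =
      {v | v ∘ Sum.inl ∈ Set.range c} ∩ {v | v ∘ Sum.inr ∈ ({d y} : Set (β → K))} := by
    ext v
    constructor
    · rintro ⟨x, rfl⟩
      exact ⟨⟨x, rfl⟩, rfl⟩
    · rintro ⟨⟨x, hx⟩, h⟩
      refine ⟨x, ?_⟩
      ext (a | a)
      · exact (congrFun hx a).symm
      · exact congrFun h a
  rw [this]
  exact (hX.preimage_comp _).inter (hy.preimage_comp _)

theorem definable_graph_comp [Finite β] (hd : d.Injective) {t : X → Y} {s : Y → Z}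
    (ht : P.Definable L (graph c d t)) (hs : P.Definable L (graph d e s)) :
    P.Definable L (graph c e (s ∘ t)) := by
  rw [graph_comp hd]
  exact definable_ex ((ht.preimage_comp _).inter (hs.preimage_comp _))

theorem definable_graph_pair (hc : c.Injective) {t : X → Y} {s : X → Z}
    (ht : P.Definable L (graph c d t)) (hs : P.Definable L (graph c e s)) :
    P.Definable L (graph c (pairC d e) fun x => (t x, s x)) := by
  rw [graph_pair hc]
  exact (ht.preimage_comp _).inter (hs.preimage_comp _)

theorem definable_range_pairC (hX : P.Definable L (Set.range c)) (hY : P.Definable L (Set.range d)) :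
    P.Definable L (Set.range (pairC c d)) := by
  rw [range_pairC]
  exact (hX.preimage_comp _).inter (hY.preimage_comp _)

theorem image_pairC_prod (U : Set X) (V : Set Y) :
    pairC c d '' (U ×ˢ V) = {v | v ∘ Sum.inl ∈ c '' U} ∩ {v | v ∘ Sum.inr ∈ d '' V} := by
  ext v
  constructor
  · rintro ⟨p, ⟨h1, h2⟩, rfl⟩
    exact ⟨⟨_, h1, rfl⟩, ⟨_, h2, rfl⟩⟩
  · rintro ⟨⟨x, h1, hx⟩, ⟨y, h2, hy⟩⟩
    refine ⟨(x, y), ⟨h1, h2⟩, ?_⟩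
    ext (a | a)
    · exact congrFun hx a
    · exact congrFun hy a

theorem image_preimage_eq (hd : d.Injective) (t : X → Y) (U : Set Y) :
    c '' (t ⁻¹' U) = {v | ∃ u, Sum.elim v u ∈
      (graph c d t ∩ {z | z ∘ Sum.inr ∈ d '' U} : Set (α ⊕ β → K))} := by
  ext v
  constructor
  · rintro ⟨x, hx, rfl⟩
    exact ⟨d (t x), ⟨x, rfl⟩, ⟨t x, hx, rfl⟩⟩
  · rintro ⟨u, ⟨x, hx⟩, ⟨y, hy, h⟩⟩
    have h1 : u = d (t x) := funext fun b => congrFun hx (Sum.inr b)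
    have h2 : y = t x := hd (h.trans h1)
    subst h2
    exact ⟨x, hy, (funext fun a => congrFun hx (Sum.inl a)).symm⟩

theorem image_image_eq (hc : c.Injective) (t : X → Y) (U : Set X) :
    d '' (t '' U) = {v | ∃ u, Sum.elim v u ∈
      ({z | z ∘ Sum.swap ∈ graph c d t} ∩ {z | z ∘ Sum.inr ∈ c '' U} : Set (β ⊕ α → K))} := by
  ext v
  constructor
  · rintro ⟨_, ⟨x, hx, rfl⟩, rfl⟩
    refine ⟨c x, ⟨x, ?_⟩, ⟨x, hx, rfl⟩⟩
    ext (a | a) <;> rfl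
  · rintro ⟨u, ⟨x, hx⟩, ⟨y, hy, h⟩⟩
    have h1 : u = c x := funext fun b => congrFun hx (Sum.inl b)
    have h2 : y = x := hc (h.trans h1)
    exact ⟨t x, ⟨x, h2 ▸ hy, rfl⟩, (funext fun a => congrFun hx (Sum.inr a)).symm⟩

theorem definable_preimage [Finite β] (hd : d.Injective) {t : X → Y}
    (ht : P.Definable L (graph c d t)) {U : Set Y} (hU : P.Definable L (d '' U)) :
    P.Definable L (c '' (t ⁻¹' U)) := by
  rw [image_preimage_eq hd]
  exact definable_ex (ht.inter (hU.preimage_comp _))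

theorem definable_image [Finite α] (hc : c.Injective) {t : X → Y}
    (ht : P.Definable L (graph c d t)) {U : Set X} (hU : P.Definable L (c '' U)) :
    P.Definable L (d '' (t '' U)) := by
  rw [image_image_eq hc]
  exact definable_ex ((ht.preimage_comp _).inter (hU.preimage_comp _))

theorem definable_image_compl (hc : c.Injective) (hX : P.Definable L (Set.range c)) {U : Set X}
    (hU : P.Definable L (c '' U)) : P.Definable L (c '' Uᶜ) := by
  rw [Set.image_compl_eq_range_sdiff_image hc]
  exact hX.sdiff hU

theorem definable_image_inter (hc : c.Injective) {U V : Set X}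
    (hU : P.Definable L (c '' U)) (hV : P.Definable L (c '' V)) : P.Definable L (c '' (U ∩ V)) := by
  rw [Set.image_inter hc]
  exact hU.inter hV

theorem definable_image_preimage_range (hX : P.Definable L (Set.range c)) {E : Set (α → K)}
    (hE : P.Definable L E) : P.Definable L (c '' (c ⁻¹' E)) := by
  rw [Set.image_preimage_eq_inter_range]
  exact hE.inter hX

/-! ### Saturation and type-definable sets -/

variable {κ : Cardinal.{w}}

theorem IsMonster.exists_of_finite (hN : IsMonster L K κ) (hP : #P < κ) [Finite α] {ι : Type*}
    (D : ι → Set (α → K)) (hD : ∀ i, P.Definable L (D i))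
    (h : ∀ s : Finset ι, ∃ x, ∀ i ∈ s, x ∈ D i) : ∃ x, ∀ i, x ∈ D i := by
  classical
  obtain ⟨k, ⟨eqv⟩⟩ := Finite.exists_equiv_fin α
  let F : Set (Set (Fin k → K)) := Set.range fun i => {y | y ∘ eqv ∈ D i}
  obtain ⟨y, hy⟩ := hN.saturated P hP k F
    (by rintro _ ⟨i, rfl⟩; exact (hD i).preimage_comp eqv) (by
    intro F₀ hF₀ hfin
    have h1 : ∀ E : F₀, ∃ i, {y : Fin k → K | y ∘ eqv ∈ D i} = E := fun E => hF₀ E.2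
    choose g hg using h1
    have := hfin.fintype
    obtain ⟨x, hx⟩ := h (Finset.univ.image g)
    refine ⟨x ∘ eqv.symm, fun E hE => ?_⟩
    have h2 := hx (g ⟨E, hE⟩) (Finset.mem_image_of_mem _ (Finset.mem_univ _))
    have h3 := hg ⟨E, hE⟩
    change {y : Fin k → K | y ∘ eqv ∈ D (g ⟨E, hE⟩)} = E at h3
    rw [← h3]
    change (x ∘ eqv.symm) ∘ eqv ∈ D _
    rwa [Function.comp_assoc, Equiv.symm_comp_self, Function.comp_id])
  exact ⟨y ∘ eqv, fun i => hy {y | y ∘ eqv ∈ D i} ⟨i, rfl⟩⟩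

theorem typeDefinable_iInter {ι : Type*} {D : ι → Set (α → K)} (h : ∀ i, TypeDefinable L P (D i)) :
    TypeDefinable L P (⋂ i, D i) := by
  choose F hF hD using h
  refine ⟨⋃ i, F i, fun E hE => ?_, ?_⟩
  · obtain ⟨i, hi⟩ := Set.mem_iUnion.1 hE
    exact hF i E hi
  · rw [Set.sInter_iUnion]
    exact Set.iInter_congr hD

theorem TypeDefinable.of_definable {D : Set (α → K)} (h : P.Definable L D) :
    TypeDefinable L P D := ⟨{D}, by simpa using h, by simp⟩

theorem TypeDefinable.inter {D E : Set (α → K)} (h : TypeDefinable L P D)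
    (h' : TypeDefinable L P E) : TypeDefinable L P (D ∩ E) := by
  rw [Set.inter_eq_iInter]
  exact typeDefinable_iInter (by rintro (_ | _) <;> assumption)

theorem TypeDefinable.mono {D : Set (α → K)} (h : TypeDefinable L P D) (hP : P ⊆ P') :
    TypeDefinable L P' D := by
  obtain ⟨F, hF, rfl⟩ := h
  exact ⟨F, fun E hE => (hF E hE).mono hP, rfl⟩

theorem TypeDefinable.preimage_comp {D : Set (β → K)} (h : TypeDefinable L P D) (ρ : β → α) :
    TypeDefinable L P {v : α → K | v ∘ ρ ∈ D} := by
  obtain ⟨F, hF, rfl⟩ := h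
  refine ⟨(fun E => {v : α → K | v ∘ ρ ∈ E}) '' F, ?_, ?_⟩
  · rintro _ ⟨E, hE, rfl⟩
    exact (hF E hE).preimage_comp ρ
  · ext v
    simp

theorem card_union_lt (hN : IsMonster L K κ) {P Q : Set K} (hP : #P < κ) (hQ : #Q < κ) :
    #(P ∪ Q : Set K) < κ :=
  (mk_union_le P Q).trans_lt (add_lt_of_lt hN.aleph0_lt.le hP hQ)

/-- By saturation, projection commutes with the intersection once the family is replaced by its
finite subintersections, and the projection of a finite subintersection is definable. -/
theorem TypeDefinable.ex (hN : IsMonster L K κ) (hP : #P < κ) [Finite α] [Finite β]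
    {D : Set (α ⊕ β → K)} (h : TypeDefinable L P D) :
    TypeDefinable L P {v : α → K | ∃ u, Sum.elim v u ∈ D} := by
  obtain ⟨F, hF, rfl⟩ := h
  have h0 : {v : α → K | ∃ u : β → K, Sum.elim v u ∈ ⋂₀ F} =
      ⋂ s : Finset {E // E ∈ F}, {v : α → K | ∃ u : β → K,
        Sum.elim v u ∈ ⋂ (E : {E // E ∈ F}) (_ : E ∈ s), (E.1 : Set (α ⊕ β → K))} := by
    ext v
    simp only [Set.mem_iInter]
    constructor
    · rintro ⟨u, hu⟩ s
      exact ⟨u, by simpa using fun E hE _ => hu E hE⟩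
    · intro hv
      have hR : #(Set.range v) < κ := by
        have : (Set.range v).Finite := Set.finite_range v
        exact this.lt_aleph0.trans hN.aleph0_lt
      -- The fibre over `v` is definable once the coordinates of `v` are added to the parameters; it
      -- is written as a projection of a set cut out by `{v}`.
      obtain ⟨u, hu⟩ := hN.exists_of_finite (card_union_lt hN hP hR)
        (fun E : F => {u : β → K | ∃ v', Sum.elim u v' ∈
          ({z | z ∘ Sum.swap ∈ (E : Set (α ⊕ β → K))} ∩ {z | z ∘ Sum.inr ∈ ({v} : Set (α → K))} :
            Set (β ⊕ α → K))})
        (fun E => definable_ex ((((hF E E.2).mono Set.subset_union_left).preimage_comp _).inter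
          ((definable_singleton (x := v) fun a => Or.inr ⟨a, rfl⟩).preimage_comp Sum.inr)))
        (fun s => by
          obtain ⟨u, hu⟩ := hv s
          refine ⟨u, fun E hE => ⟨v, ?_, rfl⟩⟩
          have : Sum.elim u v ∘ Sum.swap = Sum.elim v u := by ext (a | a) <;> rfl
          change Sum.elim u v ∘ Sum.swap ∈ E.1
          rw [this]
          exact hu E hE)
      refine ⟨u, fun E hE => ?_⟩
      obtain ⟨v', h1, h2⟩ := hu ⟨E, hE⟩
      have h3 : v' = v := h2
      subst h3
      have : Sum.elim u v' ∘ Sum.swap = Sum.elim v' u := by ext (a | a) <;> rfl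
      change Sum.elim u v' ∘ Sum.swap ∈ E at h1
      rwa [this] at h1
  rw [h0]
  exact typeDefinable_iInter fun s => .of_definable
    (definable_ex (Set.definable_biInter_finset (fun E : F => hF E E.2) s))

theorem TypeDefinable.prod {U : Set X} {V : Set Y} (hU : TypeDefinable L P (c '' U))
    (hV : TypeDefinable L P (d '' V)) : TypeDefinable L P (pairC c d '' (U ×ˢ V)) := by
  rw [image_pairC_prod]
  exact (hU.preimage_comp _).inter (hV.preimage_comp _)

theorem TypeDefinable.image_inter (hc : c.Injective) {U V : Set X}
    (hU : TypeDefinable L P (c '' U)) (hV : TypeDefinable L P (c '' V)) :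
    TypeDefinable L P (c '' (U ∩ V)) := by
  rw [Set.image_inter hc]
  exact hU.inter hV

theorem TypeDefinable.image (hN : IsMonster L K κ) (hP : #P < κ) [Finite α] [Finite β]
    (hc : c.Injective) {t : X → Y} (ht : P.Definable L (graph c d t)) {U : Set X}
    (hU : TypeDefinable L P (c '' U)) : TypeDefinable L P (d '' (t '' U)) := by
  rw [image_image_eq hc]
  exact ((TypeDefinable.of_definable (ht.preimage_comp _)).inter (hU.preimage_comp _)).ex hN hP

/-- Compactness for subsets of `X`. The index `i₀` ensures that the tuple supplied by saturation
lies in the range of `c`. -/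
theorem TypeDefinable.exists_of_finite (hN : IsMonster L K κ) (hP : #P < κ) [Finite α] {ι : Type*}
    {U : ι → Set X} (hU : ∀ i, TypeDefinable L P (c '' U i)) (hc : c.Injective) (i₀ : ι)
    (h : ∀ s : Finset ι, ∃ x, ∀ i ∈ s, x ∈ U i) : ∃ x, ∀ i, x ∈ U i := by
  classical
  choose F hF hD using hU
  obtain ⟨x, hx⟩ := hN.exists_of_finite hP (fun p : Σ i, F i => (p.2 : Set (α → K)))
    (fun p => hF p.1 p.2 p.2.2) (fun s => by
      obtain ⟨x, hx⟩ := h (s.image Sigma.fst)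
      refine ⟨c x, fun p hp => ?_⟩
      have h1 : c x ∈ c '' U p.1 := ⟨x, hx _ (Finset.mem_image_of_mem _ hp), rfl⟩
      rw [hD] at h1
      exact h1 p.2 p.2.2)
  have h2 : ∀ i, x ∈ c '' U i := fun i => by
    rw [hD]
    exact fun E hE => hx ⟨i, E, hE⟩
  obtain ⟨y, -, rfl⟩ := h2 i₀
  exact ⟨y, fun i => (hc.mem_set_image).1 (h2 i)⟩

theorem InvariantOver.of_definable {D : Set (α → K)} (h : P.Definable L D) :
    InvariantOver L P D := by
  rw [Set.definable_iff_exists_formula_sum] at h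
  obtain ⟨φ, rfl⟩ := h
  intro σ hσ x hx
  have := (StrongHomClass.realize_formula σ φ (v := Sum.elim (fun a : P => (a : K)) x)).2 hx
  have h2 : (σ : K → K) ∘ (Sum.elim (fun a : P => (a : K)) x) =
      Sum.elim (fun a : P => (a : K)) (fun i => σ (x i)) := by
    ext (a | a)
    · exact hσ _ a.2
    · rfl
  rw [h2] at this
  exact this

theorem TypeDefinable.invariantOver {D : Set (α → K)} (h : TypeDefinable L P D) :
    InvariantOver L P D := by
  obtain ⟨F, hF, rfl⟩ := h
  exact fun σ hσ x hx E hE => InvariantOver.of_definable (hF E hE) σ hσ x (hx E hE)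

end DefinableMaps

/-! ### Transfer between a model and its elementary extension. -/

section Transfer

variable {L : FirstOrder.Language.{u, v}} {M : Type w'} [L.Structure M] {N : Type w} [L.Structure N]
  {j : M ↪ₑ[L] N} {B : Set M} {α β : Type}

theorem definable_interp [Finite α] {D : Set (α → M)} (h : B.Definable L D) :
    (j '' B).Definable L (interp j D) := by
  have h' := h
  rw [Set.definable_iff_exists_formula_sum] at h
  obtain ⟨φ, rfl⟩ := h
  let ρ : B → j '' B := fun b => ⟨j b, b, b.2, rfl⟩
  rw [Set.definable_iff_exists_formula_sum]
  refine ⟨φ.relabel (Sum.map ρ id), ?_⟩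
  have h1 : Linked j {v : α → M | φ.Realize (Sum.elim (fun b : B => (b : M)) v)}
      {x | (φ.relabel (Sum.map Subtype.val id) : L.Formula (M ⊕ α)).Realize (Sum.elim j x)} := by
    refine ⟨φ.relabel (Sum.map Subtype.val id), ?_, rfl⟩
    ext v
    simp only [Set.mem_ofPred_eq, Formula.realize_relabel]
    rw [Sum.elim_comp_map]
    rfl
  have h2 := h1.interp_eq
  refine h2.trans ?_
  ext v
  simp only [Set.mem_ofPred_eq, Formula.realize_relabel, Sum.elim_comp_map]
  rfl

/-- By elementarity the same formula defines the trace on `M`. This brings thick sets found in `G*`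
down to `G`. -/
theorem definable_restrict {D : Set (α → N)} (h : (j '' B).Definable L D) :
    B.Definable L {v : α → M | (fun i => j (v i)) ∈ D} := by
  rw [Set.definable_iff_exists_formula_sum] at h
  obtain ⟨φ, rfl⟩ := h
  have h0 : ∀ p : j '' B, ∃ b : B, j b = p := fun p => by
    obtain ⟨b, hb, h⟩ := p.2
    exact ⟨⟨b, hb⟩, h⟩
  choose ρ hρ using h0
  rw [Set.definable_iff_exists_formula_sum]
  refine ⟨φ.relabel (Sum.map ρ id), ?_⟩
  ext v
  simp only [Set.mem_ofPred_eq, Formula.realize_relabel, Sum.elim_comp_map]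
  rw [← j.map_formula]
  refine iff_of_eq (congrArg _ ?_)
  ext (a | a)
  · exact (hρ a).symm
  · rfl

theorem linked_iUnion {ι : Type*} [Finite ι] {P : ι → Set (α → M)} {Q : ι → Set (α → N)}
    (h : ∀ i, Linked j (P i) (Q i)) : Linked j (⋃ i, P i) (⋃ i, Q i) := by
  choose φ hP hQ using h
  refine ⟨Formula.iSup φ, ?_, ?_⟩ <;> ext v <;> simp [Formula.realize_iSup, hP, hQ]

variable {X Y : Type*} {X' Y' : Type*} {c : X → α → M} {c' : X' → α → N} {d : Y → β → M}
  {d' : Y' → β → N}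

theorem linked_preimage [Finite β] (hd : d.Injective) (hd' : d'.Injective) {t : X → Y}
    {t' : X' → Y'} (ht : Linked j (graph c d t) (graph c' d' t')) {U : Set Y} {U' : Set Y'}
    (hU : Linked j (d '' U) (d' '' U')) : Linked j (c '' (t ⁻¹' U)) (c' '' (t' ⁻¹' U')) := by
  rw [image_preimage_eq hd, image_preimage_eq hd']
  exact (ht.inter (hU.relabel _)).ex

theorem linked_image_inter (hc : c.Injective) (hc' : c'.Injective) {U V : Set X} {U' V' : Set X'}
    (hU : Linked j (c '' U) (c' '' U')) (hV : Linked j (c '' V) (c' '' V')) :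
    Linked j (c '' (U ∩ V)) (c' '' (U' ∩ V')) := by
  rw [Set.image_inter hc, Set.image_inter hc']
  exact hU.inter hV

theorem Linked.image_subset [Finite α] (hc' : c'.Injective) {U V : Set X} {U' V' : Set X'}
    (hU : Linked j (c '' U) (c' '' U')) (hV : Linked j (c '' V) (c' '' V')) (h : U ⊆ V) :
    U' ⊆ V' :=
  (Set.image_subset_image_iff hc').1 (hU.subset hV (Set.image_mono h))

end Transfer

section Transfer

variable {L : FirstOrder.Language.{u, v}} {M : Type w'} [L.Structure M] {N : Type w} [L.Structure N]
  {j : M ↪ₑ[L] N} {B : Set M} {α β : Type} {X Y : Type*} {X' Y' : Type*} {c : X → α → M}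
  {c' : X' → α → N} {d : Y → β → M} {d' : Y' → β → N}

theorem definable_graph_interpMap [Finite α] [Finite β] (hc : c.Injective)
    (hX : Linked j (Set.range c) (Set.range c')) (hY : Linked j (Set.range d) (Set.range d'))
    (t : X → Y) {B B' : Set M} (ht : B.Definable L (graph c d t)) (hB : B ⊆ B') :
    (j '' B').Definable L (graph c' d' (interpMap hc hX hY t ht)) := by
  rw [← graph_interpMap hc hX hY t ht]
  exact (definable_interp ht).mono (Set.image_mono hB)

end Transfer

/-! ### Definability in `A*`, `G*` and the extension; the interpretation of `f`. -/

namespace CocycleData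

variable {L : FirstOrder.Language.{u, v}} {M : Type w'} [L.Structure M] {N : Type w} [L.Structure N]
  {B : Set M} (S : CocycleData L M B) {j : M ↪ₑ[L] N}

theorem definable_range_gc : (j '' B).Definable L (Set.range (S.gc (j := j))) := by
  have h : Set.range (S.gc (j := j)) = interp j S.G := Subtype.range_val
  rw [h]
  exact (definable_interp S.definable_G).mono (Set.image_mono (Set.empty_subset _))

theorem definable_range_ac : (j '' B).Definable L (Set.range (S.ac (j := j))) := by
  have h : Set.range (S.ac (j := j)) = interp j S.A := Subtype.range_val
  rw [h]
  exact (definable_interp S.definable_A).mono (Set.image_mono (Set.empty_subset _))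

theorem definable_graph_mul : (j '' B).Definable L
    (graph (pairC S.gc S.gc) S.gc fun p : S.GStar j × S.GStar j => p.1 * p.2) :=
  definable_graph_interpMap (pairC_injective Subtype.val_injective Subtype.val_injective)
    (linked_range_pairC S.linked_G S.linked_G) S.linked_G _ S.definable_mul (Set.empty_subset _)

theorem definable_graph_add : (j '' B).Definable L
    (graph (pairC S.ac S.ac) S.ac fun p : S.AStar j × S.AStar j => p.1 + p.2) :=
  definable_graph_interpMap (pairC_injective Subtype.val_injective Subtype.val_injective)
    (linked_range_pairC S.linked_A S.linked_A) S.linked_A _ S.definable_add (Set.empty_subset _)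

theorem definable_graph_smul : (j '' B).Definable L
    (graph (pairC S.gc S.ac) S.ac fun p : S.GStar j × S.AStar j => p.1 • p.2) :=
  definable_graph_interpMap (pairC_injective Subtype.val_injective Subtype.val_injective)
    (linked_range_pairC S.linked_G S.linked_A) S.linked_A _ S.definable_smul (Set.empty_subset _)

/-- The values of `h` lie in the definable closure of `B`; this is what makes automorphisms over `B`
fix `A₀` pointwise. -/
theorem definable_incA_h (p : S.G × S.G) :
    (j '' B).Definable L ({S.ac (S.incA j (S.h p))} : Set (Fin S.m → N)) := by
  have h1 : Linked j ({(S.h p : Fin S.m → M)} : Set (Fin S.m → M))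
      ({S.ac (S.incA j (S.h p))} : Set (Fin S.m → N)) := by
    have := linked_eqs (j := j) (fun b : Fin S.m => Sum.inr b)
      (fun b : Fin S.m => Sum.inl ((S.h p : Fin S.m → M) b))
    convert this using 1
    · ext v
      simp [funext_iff]
    · ext v
      simp only [Set.mem_singleton_iff, funext_iff]
      rfl
  rw [← h1.interp_eq]
  exact definable_interp (S.h_mem_dcl p)

theorem definable_zero : (j '' B).Definable L ({S.ac (0 : S.AStar j)} : Set (Fin S.m → N)) := by
  -- Zero is itself a value of the cocycle.
  have := S.definable_incA_h (j := j) (1, 1)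
  rwa [S.h_one_left, map_zero] at this

/-- Negation on `A*` comes from a choice of inverses, so its definability is recovered from that of
addition and of zero. -/
theorem definable_graph_neg : (j '' B).Definable L
    (graph S.ac S.ac fun a : S.AStar j => -a) := by
  have h : graph S.ac S.ac (fun a : S.AStar j => -a) =
      pairC S.ac S.ac '' ((fun p : S.AStar j × S.AStar j => p.1 + p.2) ⁻¹' {0}) := by
    rw [graph_eq_image]
    congr 1
    ext p
    simp [neg_eq_iff_add_eq_zero]
  rw [h]
  refine definable_preimage S.ac_injective S.definable_graph_add ?_
  rw [Set.image_singleton]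
  exact S.definable_zero

/-- As the range of `h` is finite, "`h` takes one of these values" is first-order and passes to `N`:
the interpretation has no new values. -/
theorem hStar_mem_image (p : S.GStar j × S.GStar j) : ∃ q, S.hStar j p = S.incA j (S.h q) := by
  have := S.finite_h.to_subtype
  have h1 : ∀ e : Set.range S.h, Linked j
      (pairC Subtype.val Subtype.val '' (S.h ⁻¹' {e.1}))
      (pairC S.gc S.gc '' (S.hStar j ⁻¹' {S.incA j e.1})) := fun e => by
    refine linked_preimage Subtype.val_injective S.ac_injective
      (linked_interpMap _ _ _ _ S.definable_h) ?_
    rw [Set.image_singleton, Set.image_singleton]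
    have := linked_eqs (j := j) (fun b : Fin S.m => Sum.inr b)
      (fun b : Fin S.m => Sum.inl ((e.1 : Fin S.m → M) b))
    convert this using 1
    · ext v
      simp [funext_iff]
    · ext v
      simp only [Set.mem_singleton_iff, funext_iff]
      rfl
  have h2 := (linked_range_pairC S.linked_G S.linked_G).subset (linked_iUnion h1) (by
    rintro _ ⟨q, rfl⟩
    exact Set.mem_iUnion.2 ⟨⟨S.h q, q, rfl⟩, q, rfl, rfl⟩) ⟨p, rfl⟩
  obtain ⟨⟨_, q, rfl⟩, hq⟩ := Set.mem_iUnion.1 h2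
  exact ⟨q, ((pairC_injective S.gc_injective S.gc_injective).mem_set_image).1 hq⟩

theorem incA_h_mem_A0Star (q : S.G × S.G) : S.incA j (S.h q) ∈ S.A0Star j :=
  AddSubgroup.mem_map_of_mem _ (AddSubgroup.subset_closure ⟨q, rfl⟩)

theorem hStar_mem_A0Star (p : S.GStar j × S.GStar j) : S.hStar j p ∈ S.A0Star j := by
  obtain ⟨q, hq⟩ := S.hStar_mem_image p
  rw [hq]
  exact S.incA_h_mem_A0Star q

theorem A0Star_eq_closure :
    S.A0Star j = AddSubgroup.closure (Set.range fun q => S.incA j (S.h q)) := by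
  rw [A0Star, A0, AddMonoidHom.map_closure, ← Set.range_comp]
  rfl

/-! ### The extension group -/

theorem Ext.mul_a (x y : S.Ext j) : (x * y).a = x.a + x.g • y.a + S.hStar j (x.g, y.g) := rfl

theorem Ext.one_a : (1 : S.Ext j).a = 0 := rfl

theorem Ext.one_g : (1 : S.Ext j).g = 1 := rfl

variable (j) in
/-- The projection of the extension onto `G*`. -/
def extProj : S.Ext j →* S.GStar j where
  toFun := Ext.g
  map_one' := rfl
  map_mul' _ _ := rfl

theorem ec_injective : Function.Injective (S.ec (j := j)) := by
  intro x y h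
  have h1 := S.ac_injective (funext fun i => congrFun h (Sum.inl i) : S.ac x.a = S.ac y.a)
  have h2 := S.gc_injective (funext fun i => congrFun h (Sum.inr i) : S.gc x.g = S.gc y.g)
  exact Ext.ext h1 h2

theorem range_ec : Set.range (S.ec (j := j)) = Set.range (pairC (S.ac (j := j)) (S.gc (j := j))) := by
  ext v
  constructor
  · rintro ⟨x, rfl⟩
    exact ⟨(x.a, x.g), rfl⟩
  · rintro ⟨p, rfl⟩
    exact ⟨⟨p.1, p.2⟩, rfl⟩

theorem definable_range_ec : (j '' B).Definable L (Set.range (S.ec (j := j))) := by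
  rw [range_ec]
  exact definable_range_pairC S.definable_range_ac S.definable_range_gc

theorem definable_graph_ext_a : (j '' B).Definable L (graph S.ec S.ac (Ext.a (S := S) (j := j))) :=
  definable_graph_coord Sum.inl S.definable_range_ec fun _ => rfl

theorem definable_graph_ext_g : (j '' B).Definable L (graph S.ec S.gc (Ext.g (S := S) (j := j))) :=
  definable_graph_coord Sum.inr S.definable_range_ec fun _ => rfl

/-! ### The interpretation of the splitting function -/

section Splitting

variable {H : Subgroup S.G} {f : H → S.A}

variable (j H f) in
/-- The graph of the interpretation of `f : H → A`. -/
def graphStar : Set (S.GStar j × S.AStar j) :=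
  {p | Sum.elim (S.gc p.1) (S.ac p.2) ∈ interp j (graph (S.subC H) Subtype.val f)}

theorem subC_injective : Function.Injective (S.subC H) :=
  fun _ _ h => Subtype.ext (Subtype.ext h)

theorem range_subC : Set.range (S.subC H) = Subtype.val '' (H : Set S.G) := by
  ext v
  constructor
  · rintro ⟨x, rfl⟩
    exact ⟨x, x.2, rfl⟩
  · rintro ⟨x, hx, rfl⟩
    exact ⟨⟨x, hx⟩, rfl⟩

variable (hH : B.Definable L (Subtype.val '' (H : Set S.G)))
  (hf : B.Definable L (graph (S.subC H) Subtype.val f))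

include hf in
theorem image_graphStar : pairC S.gc S.ac '' S.graphStar j H f =
    interp j (graph (S.subC H) Subtype.val f) := by
  refine Set.Subset.antisymm (by rintro _ ⟨p, hp, rfl⟩; exact hp) fun v hv => ?_
  have h1 := (linked_interp hf (j := j)).subset (linked_range_pairC S.linked_G S.linked_A) (by
    rintro _ ⟨x, rfl⟩
    exact ⟨(x.1, f x), rfl⟩) hv
  obtain ⟨p, rfl⟩ := h1
  exact ⟨p, hv, rfl⟩

include hf in
theorem definable_graphStar : (j '' B).Definable L (pairC S.gc S.ac '' S.graphStar j H f) := by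
  rw [S.image_graphStar hf]
  exact definable_interp hf

include hf in
theorem incG_incA_mem_graphStar (x : H) : (S.incG j x, S.incA j (f x)) ∈ S.graphStar j H f := by
  have := (mem_interp (linked_interp hf (j := j))
    (v := Sum.elim (S.subC H x) (f x : Fin S.m → M))).2 ⟨x, rfl⟩
  change Sum.elim _ _ ∈ interp j (graph (S.subC H) Subtype.val f)
  convert this using 1
  ext (a | a) <;> rfl

variable (j H) in
/-- The interpretation of the subgroup `H` of `G`. -/
def HStar : Set (S.GStar j) := {g | S.gc g ∈ interp j (Subtype.val '' (H : Set S.G))}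

variable (j H) in
/-- Coordinates of an element of `HStar`. -/
def hc (x : S.HStar j H) : Fin S.n → N := S.gc x.1

theorem hc_injective : Function.Injective (S.hc j H) :=
  fun _ _ h => Subtype.ext (S.gc_injective h)

include hH in
theorem linked_H : Linked j (Subtype.val '' (H : Set S.G)) (S.gc '' S.HStar j H) := by
  have h1 : S.gc '' S.HStar j H = interp j (Subtype.val '' (H : Set S.G)) := by
    refine Set.Subset.antisymm (by rintro _ ⟨p, hp, rfl⟩; exact hp) fun v hv => ?_
    have h1 := (linked_interp hH (j := j)).subset S.linked_G (by
      rintro _ ⟨x, -, rfl⟩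
      exact ⟨x, rfl⟩) hv
    obtain ⟨p, rfl⟩ := h1
    exact ⟨p, hv, rfl⟩
  rw [h1]
  exact linked_interp hH

include hH in
theorem linked_range_subC : Linked j (Set.range (S.subC H)) (Set.range (S.hc j H)) := by
  have h1 : Set.range (S.hc j H) = S.gc '' S.HStar j H := by
    ext v
    constructor
    · rintro ⟨x, rfl⟩
      exact ⟨x, x.2, rfl⟩
    · rintro ⟨x, hx, rfl⟩
      exact ⟨⟨x, hx⟩, rfl⟩
  rw [h1, range_subC]
  exact S.linked_H hH

include hH hf in
theorem exists_fStar : ∃ f' : S.HStar j H → S.AStar j,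
    interp j (graph (S.subC H) Subtype.val f) = graph (S.hc j H) S.ac f' :=
  linked_map_exists S.subC_injective (S.linked_range_subC hH) S.linked_A (linked_interp hf)

theorem mem_graphStar_iff {f' : S.HStar j H → S.AStar j}
    (hf' : interp j (graph (S.subC H) Subtype.val f) = graph (S.hc j H) S.ac f')
    {g : S.GStar j} {a : S.AStar j} :
    (g, a) ∈ S.graphStar j H f ↔ ∃ hg : g ∈ S.HStar j H, f' ⟨g, hg⟩ = a := by
  constructor
  · intro h
    change Sum.elim _ _ ∈ interp j (graph (S.subC H) Subtype.val f) at h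
    rw [hf'] at h
    obtain ⟨x, hx⟩ := h
    have h1 : g = x.1 := S.gc_injective (funext fun i => congrFun hx (Sum.inl i))
    have h2 : a = f' x := S.ac_injective (funext fun i => congrFun hx (Sum.inr i))
    subst h1
    exact ⟨x.2, h2.symm⟩
  · rintro ⟨hg, rfl⟩
    change Sum.elim _ _ ∈ interp j (graph (S.subC H) Subtype.val f)
    rw [hf']
    exact ⟨⟨g, hg⟩, rfl⟩

include hH hf in
theorem graphStar_unique {g : S.GStar j} {a b : S.AStar j} (ha : (g, a) ∈ S.graphStar j H f)
    (hb : (g, b) ∈ S.graphStar j H f) : a = b := by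
  obtain ⟨f', hf'⟩ := S.exists_fStar hH hf (j := j)
  obtain ⟨h1, rfl⟩ := (S.mem_graphStar_iff hf').1 ha
  obtain ⟨h2, rfl⟩ := (S.mem_graphStar_iff hf').1 hb
  rfl

include hH hf in
theorem mem_HStar_iff {g : S.GStar j} :
    g ∈ S.HStar j H ↔ ∃ a, (g, a) ∈ S.graphStar j H f := by
  obtain ⟨f', hf'⟩ := S.exists_fStar hH hf (j := j)
  constructor
  · exact fun hg => ⟨f' ⟨g, hg⟩, (S.mem_graphStar_iff hf').2 ⟨hg, rfl⟩⟩
  · rintro ⟨a, ha⟩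
    exact ((S.mem_graphStar_iff hf').1 ha).1

include hH in
theorem linked_incl : Linked j (graph (S.subC H) Subtype.val (Subtype.val : H → S.G))
    (graph (S.hc j H) S.gc Subtype.val) :=
  linked_proj id (S.linked_range_subC hH) (fun _ => rfl) fun _ => rfl

include hH hf in
-- The splitting identity for `f*`, transferred from `M`. It says exactly that the points `(-f*(x),
-- x)` are closed under multiplication in the extension.
theorem graphStar_mul (hf_split : ∀ x y : H, S.h (x, y) = f x + (x : S.G) • f y - f (x * y))
    {g g' : S.GStar j} {a a' : S.AStar j} (h : (g, a) ∈ S.graphStar j H f)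
    (h' : (g', a') ∈ S.graphStar j H f) :
    (g * g', a + g • a' - S.hStar j (g, g')) ∈ S.graphStar j H f := by
  obtain ⟨f', hf'⟩ := S.exists_fStar hH hf (j := j)
  obtain ⟨hg, rfl⟩ := (S.mem_graphStar_iff hf').1 h
  obtain ⟨hg', rfl⟩ := (S.mem_graphStar_iff hf').1 h'
  have k := S.linked_range_subC hH (j := j)
  have i := pairC_injective (S.subC_injective (H := H)) (S.subC_injective (H := H))
  have i' := pairC_injective (S.hc_injective (j := j) (H := H)) (S.hc_injective (j := j) (H := H))
  have q1 := linked_comp S.subC_injective S.hc_injective (linked_fst k k) (S.linked_incl hH)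
  have q2 := linked_comp S.subC_injective S.hc_injective (linked_snd k k) (S.linked_incl hH)
  have m1 := S.linked_mulStar i i' q1 q2
  -- The multiplication of `H` is interpreted as a map `μ` with values in `HStar`; identifying it
  -- with the product of `G*` also shows that `HStar` is closed under products.
  have e : graph (pairC (S.subC H) (S.subC H)) Subtype.val
      (fun x : H × H => ((Subtype.val ∘ Prod.fst) x * (Subtype.val ∘ Prod.snd) x : S.G)) =
      graph (pairC (S.subC H) (S.subC H)) (S.subC H) fun x : H × H => x.1 * x.2 := rfl
  obtain ⟨μ, hμ⟩ := linked_map_exists i (linked_range_pairC k k) k (m1.congr e)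
  have m2 : Linked j (graph (pairC (S.subC H) (S.subC H)) (S.subC H) fun x : H × H => x.1 * x.2)
      (graph (pairC (S.hc j H) (S.hc j H)) (S.hc j H) μ) := hμ ▸ m1.congr e
  have lf : Linked j (graph (S.subC H) Subtype.val f) (graph (S.hc j H) S.ac f') :=
    hf' ▸ linked_interp hf
  have f1 := linked_comp S.subC_injective S.hc_injective (linked_fst k k) lf
  have f2 := linked_comp S.subC_injective S.hc_injective (linked_snd k k) lf
  have f3 := linked_comp S.subC_injective S.hc_injective m2 lf
  have key := linked_map_unique i' S.ac_injective
    (S.linked_addStar i i' (S.linked_hStar i i' q1 q2) f3)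
    (S.linked_addStar i i' f1 (S.linked_smulStar i i' q1 f2))
    (fun p => by simp [hf_split]) (⟨g, hg⟩, ⟨g', hg'⟩)
  have key2 := linked_map_unique i' S.gc_injective m1
    (linked_comp S.subC_injective S.hc_injective m2 (S.linked_incl hH))
    (fun p => rfl) (⟨g, hg⟩, ⟨g', hg'⟩)
  change S.hStar j (g, g') + f' (μ (⟨g, hg⟩, ⟨g', hg'⟩)) = f' ⟨g, hg⟩ + g • f' ⟨g', hg'⟩ at key
  change g * g' = (μ (⟨g, hg⟩, ⟨g', hg'⟩)).1 at key2
  refine (S.mem_graphStar_iff hf').2 ⟨key2 ▸ Subtype.prop _, ?_⟩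
  rw [← key, add_sub_cancel_left]
  congr 1
  exact Subtype.ext key2

include hf in
theorem graphStar_one (hf_one : f 1 = 0) : ((1, 0) : S.GStar j × S.AStar j) ∈ S.graphStar j H f := by
  have := S.incG_incA_mem_graphStar hf (j := j) 1
  rw [hf_one, map_zero] at this
  exact this

theorem linked_graph_mul : Linked j
    (graph (pairC Subtype.val Subtype.val) Subtype.val fun p : S.G × S.G => p.1 * p.2)
    (graph (pairC S.gc S.gc) S.gc fun p : S.GStar j × S.GStar j => p.1 * p.2) :=
  linked_interpMap (pairC_injective Subtype.val_injective Subtype.val_injective)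
    (linked_range_pairC S.linked_G S.linked_G) S.linked_G _ S.definable_mul

include hH in
-- This form of closure under inverses mentions only multiplication, so it transfers without
-- interpreting inversion.
theorem mem_HStar_of_mul {x y : S.GStar j} (hx : x ∈ S.HStar j H) (hxy : x * y ∈ S.HStar j H) :
    y ∈ S.HStar j H := by
  have l := S.linked_H hH (j := j)
  have i := pairC_injective (S.gc_injective (j := j)) (S.gc_injective (j := j))
  have i₀ := pairC_injective (Subtype.val_injective (p := (· ∈ S.G)))
    (Subtype.val_injective (p := (· ∈ S.G)))
  have h1 := linked_preimage Subtype.val_injective S.gc_injective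
    (linked_fst S.linked_G S.linked_G) l
  have h2 := linked_preimage Subtype.val_injective S.gc_injective S.linked_graph_mul l
  have h3 := linked_preimage Subtype.val_injective S.gc_injective
    (linked_snd S.linked_G S.linked_G) l
  exact (linked_image_inter i₀ i h1 h2).image_subset i h3
    (fun p hp => (H.mul_mem_cancel_left hp.1).1 hp.2) (show (x, y) ∈ _ from ⟨hx, hxy⟩)

include hH in
-- That the finitely many cosets of `H` cover `G` is first-order with their representatives as
-- parameters, so the same representatives work for `G*`.
theorem exists_mul_mem_HStar [H.FiniteIndex] (x : S.GStar j) :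
    ∃ r : S.G ⧸ H, S.incG j r.out⁻¹ * x ∈ S.HStar j H := by
  have l := S.linked_H hH (j := j)
  have h1 : ∀ r : S.G ⧸ H, Linked j
      (Subtype.val '' ((fun x => r.out⁻¹ * x) ⁻¹' (H : Set S.G)))
      (S.gc '' ((fun x => S.incG j r.out⁻¹ * x) ⁻¹' S.HStar j H)) := fun r =>
    linked_preimage Subtype.val_injective S.gc_injective
      (S.linked_mulStar Subtype.val_injective S.gc_injective
        (linked_const S.linked_G _ _ fun _ => rfl) (linked_id S.linked_G)) l
  have h2 := S.linked_G.subset (linked_iUnion h1) (by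
    rintro _ ⟨q, rfl⟩
    refine Set.mem_iUnion.2 ⟨(q : S.G ⧸ H), q, ?_, rfl⟩
    exact QuotientGroup.eq.1 (QuotientGroup.out_eq' (q : S.G ⧸ H))) ⟨x, rfl⟩
  obtain ⟨r, hr⟩ := Set.mem_iUnion.1 h2
  exact ⟨r, ((S.gc_injective (j := j)).mem_set_image
    (s := (fun x => S.incG j r.out⁻¹ * x) ⁻¹' S.HStar j H)).1 hr⟩

include hH hf in
variable (j) in
/-- The image of the homomorphism `x ↦ (-f*(x), x)` from `H*` to the extension. -/
def sectionGroup (hf_one : f 1 = 0)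
    (hf_split : ∀ x y : H, S.h (x, y) = f x + (x : S.G) • f y - f (x * y)) :
    Subgroup (S.Ext j) where
  carrier := {x | (x.g, -x.a) ∈ S.graphStar j H f}
  one_mem' := by
    have := S.graphStar_one hf hf_one (j := j)
    rw [Set.mem_ofPred_eq, Ext.one_a, neg_zero]
    exact this
  mul_mem' {x y} hx hy := by
    have := S.graphStar_mul hH hf hf_split hx hy
    have e : -(x * y).a = -x.a + x.g • -y.a - S.hStar j (x.g, y.g) := by
      rw [Ext.mul_a, smul_neg]
      abel
    rw [Set.mem_ofPred_eq, e]
    exact this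
  inv_mem' {x} hx := by
    have h1 : x.g ∈ S.HStar j H := (S.mem_HStar_iff hH hf).2 ⟨_, hx⟩
    have h2 : x.g⁻¹ ∈ S.HStar j H := by
      refine S.mem_HStar_of_mul hH h1 ?_
      rw [mul_inv_cancel]
      exact (S.mem_HStar_iff hH hf).2 ⟨_, S.graphStar_one hf hf_one⟩
    obtain ⟨b, hb⟩ := (S.mem_HStar_iff hH hf).1 h2
    -- With `b = f*(g⁻¹)`, the product rule together with `f*(1) = 0` shows that `(-b, g⁻¹)` is a
    -- right inverse of `x`.
    have h3 := S.graphStar_mul hH hf hf_split hx hb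
    rw [mul_inv_cancel] at h3
    have h4 := S.graphStar_unique hH hf h3 (S.graphStar_one hf hf_one)
    have h5 : x * ⟨-b, x.g⁻¹⟩ = 1 := by
      refine Ext.ext ?_ (mul_inv_cancel _)
      rw [Ext.mul_a, Ext.one_a, ← neg_eq_zero, ← h4, smul_neg]
      abel
    rw [inv_eq_of_mul_eq_one_right h5, Set.mem_ofPred_eq, neg_neg]
    exact hb

end Splitting

end CocycleData

/-! ### Bounds on indices and small parameter sets. -/

theorem card_quotient_lt {X T : Type w} [Group X] {K : Subgroup X} {κ : Cardinal.{w}} (θ : X → T)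
    (hT : #T < κ) (h : ∀ x y, θ x = θ y → x⁻¹ * y ∈ K) : #(X ⧸ K) < κ := by
  refine (mk_le_of_injective (f := fun q : X ⧸ K => θ q.out) fun p q hpq => ?_).trans_lt hT
  have := QuotientGroup.eq.2 (h _ _ hpq)
  rwa [QuotientGroup.out_eq', QuotientGroup.out_eq'] at this

theorem card_fin_arrow_lt {κ : Cardinal.{w}} (hκ : ℵ₀ < κ) {Q : Type w} (hQ : #Q < κ) (k : ℕ) :
    #(Fin k → Q) < κ := by
  have h1 : #(Fin k → Q) = #Q ^ k := by simp
  rw [h1]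
  calc #Q ^ k ≤ (max #Q ℵ₀) ^ k := by
        rw [← Cardinal.power_natCast, ← Cardinal.power_natCast]
        exact Cardinal.power_le_power_right (le_max_left _ _)
    _ ≤ max #Q ℵ₀ := Cardinal.power_nat_le (le_max_right _ _)
    _ < κ := max_lt hQ hκ

theorem image_small {M : Type w'} {N : Type w} {κ : Cardinal.{w}} (hκ : ℵ₀ < κ) (j : M → N)
    {B : Set M} (hB : B.Finite) : #(j '' B) < κ :=
  ((hB.image j).lt_aleph0).trans hκ

/-! ### Automorphisms over `B`, the invariant subgroup, and the first implication. -/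

section Conjugation

variable {L : FirstOrder.Language.{u, v}} {K : Type w} [L.Structure K] {P : Set K}
  {α β : Type} {X Y : Type*} {c : X → α → K} {d : Y → β → K}

/-- Definable maps commute with automorphisms over the parameters. Instead of an action of `σ` on
`X`, the relation `c x' = σ ∘ c x` between points is used. -/
theorem apply_graph_of_definable (hc : c.Injective) {t : X → Y} (ht : P.Definable L (graph c d t))
    {σ : K ≃[L] K} (hσ : ∀ p ∈ P, σ p = p) {x x' : X} (hx : c x' = σ ∘ c x) :
    d (t x') = σ ∘ d (t x) := by
  obtain ⟨y, hy⟩ := InvariantOver.of_definable ht σ hσ _ ⟨x, rfl⟩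
  have h1 : x' = y := hc (hx.trans (funext fun a => congrFun hy (Sum.inl a)))
  subst h1
  exact (funext fun a => congrFun hy (Sum.inr a)).symm

theorem exists_conj (hX : P.Definable L (Set.range c)) {σ : K ≃[L] K} (hσ : ∀ p ∈ P, σ p = p)
    (x : X) : ∃ x', c x' = σ ∘ c x :=
  InvariantOver.of_definable hX σ hσ _ ⟨x, rfl⟩

end Conjugation

namespace CocycleData

variable {L : FirstOrder.Language.{u, v}} {M : Type w'} [L.Structure M] {N : Type w} [L.Structure N]
  {B : Set M} (S : CocycleData L M B) {j : M ↪ₑ[L] N} {κ : Cardinal.{w}}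
  {A₁ : AddSubgroup (S.AStar j)}

section Conjugation

variable {σ : N ≃[L] N} (hσ : ∀ b ∈ j '' B, σ b = b)

include hσ in
theorem conj_add {a a' b b' : S.AStar j} (ha : S.ac a' = σ ∘ S.ac a) (hb : S.ac b' = σ ∘ S.ac b) :
    S.ac (a' + b') = σ ∘ S.ac (a + b) := by
  refine apply_graph_of_definable (pairC_injective S.ac_injective S.ac_injective)
    S.definable_graph_add hσ (x := (a, b)) (x' := (a', b')) ?_
  ext (i | i)
  · exact congrFun ha i
  · exact congrFun hb i

include hσ in
theorem conj_smul {g g' : S.GStar j} {b b' : S.AStar j} (hg : S.gc g' = σ ∘ S.gc g)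
    (hb : S.ac b' = σ ∘ S.ac b) : S.ac (g' • b') = σ ∘ S.ac (g • b) := by
  refine apply_graph_of_definable (pairC_injective S.gc_injective S.ac_injective)
    S.definable_graph_smul hσ (x := (g, b)) (x' := (g', b')) ?_
  ext (i | i)
  · exact congrFun hg i
  · exact congrFun hb i

include hσ in
theorem conj_neg {a a' : S.AStar j} (ha : S.ac a' = σ ∘ S.ac a) : S.ac (-a') = σ ∘ S.ac (-a) :=
  apply_graph_of_definable S.ac_injective S.definable_graph_neg hσ ha

include hσ in
theorem conj_A0Star {a : S.AStar j} (ha : a ∈ S.A0Star j) : S.ac a = σ ∘ S.ac a := by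
  rw [A0Star_eq_closure] at ha
  induction ha using AddSubgroup.closure_induction with
  | mem x hx =>
    obtain ⟨q, rfl⟩ := hx
    exact (InvariantOver.of_definable (S.definable_incA_h q) σ hσ _ rfl).symm
  | zero => exact (InvariantOver.of_definable S.definable_zero σ hσ _ rfl).symm
  | add x y _ _ hx hy => exact S.conj_add hσ hx hy
  | neg x _ hx => exact S.conj_neg hσ hx

include hσ in
theorem conj_mem (hA₁ : TypeDefinable L (j '' B) (S.ac '' (A₁ : Set (S.AStar j))))
    {a a' : S.AStar j} (h : S.ac a' = σ ∘ S.ac a) (ha : a ∈ A₁) : a' ∈ A₁ := by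
  obtain ⟨b, hb, hb'⟩ := hA₁.invariantOver σ hσ _ ⟨a, ha, rfl⟩
  have : a' = b := S.ac_injective (h.trans hb'.symm)
  rwa [this]

end Conjugation

variable (hA₁_inv : ∀ (g : S.GStar j), ∀ a ∈ A₁, g • a ∈ A₁)

include hA₁_inv in
-- Trivial action modulo `A₁` need only be tested on the generators of `A₀`, since `A₁` is stable
-- under `G*`.
theorem smul_sub_mem_of_mem_sup {g : S.GStar j}
    (hg : ∀ q, g • S.incA j (S.h q) - S.incA j (S.h q) ∈ A₁) {a : S.AStar j}
    (ha : a ∈ S.A0Star j ⊔ A₁) : g • a - a ∈ A₁ := by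
  obtain ⟨b, hb, d, hd, rfl⟩ := AddSubgroup.mem_sup.1 ha
  have h1 : g • b - b ∈ A₁ := by
    rw [A0Star_eq_closure] at hb
    clear ha
    induction hb using AddSubgroup.closure_induction with
    | mem x hx =>
      obtain ⟨q, rfl⟩ := hx
      exact hg q
    | zero => simp
    | add x y _ _ hx hy =>
      have := A₁.add_mem hx hy
      rwa [sub_add_sub_comm, ← smul_add] at this
    | neg x _ hx =>
      have := A₁.neg_mem hx
      rwa [neg_sub, ← neg_sub_neg, ← smul_neg] at this
  have := A₁.add_mem h1 (A₁.sub_mem (hA₁_inv g d hd) hd)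
  rwa [sub_add_sub_comm, ← smul_add] at this

include hA₁_inv in
theorem smul_mem_sup {g : S.GStar j}
    (hg : ∀ q, g • S.incA j (S.h q) - S.incA j (S.h q) ∈ A₁) {a : S.AStar j}
    (ha : a ∈ S.A0Star j ⊔ A₁) : g • a ∈ S.A0Star j ⊔ A₁ := by
  have := add_mem ((le_sup_right : A₁ ≤ S.A0Star j ⊔ A₁) (S.smul_sub_mem_of_mem_sup hA₁_inv hg ha)) ha
  rwa [sub_add_cancel] at this

theorem hStar_mem_sup (p : S.GStar j × S.GStar j) : S.hStar j p ∈ S.A0Star j ⊔ A₁ :=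
  (le_sup_left : S.A0Star j ≤ S.A0Star j ⊔ A₁) (S.hStar_mem_A0Star p)

/-- The subgroup of the extension consisting of the `(a, g)` with `a ∈ A₀ + A₁` and `g` acting
trivially on `A₀` modulo `A₁`. -/
def trivSubgroup : Subgroup (S.Ext j) where
  carrier := {x | x.a ∈ S.A0Star j ⊔ A₁ ∧ ∀ q, x.g • S.incA j (S.h q) - S.incA j (S.h q) ∈ A₁}
  one_mem' := ⟨zero_mem _, fun q => by rw [Ext.one_g, one_smul, sub_self]; exact zero_mem _⟩
  mul_mem' {x y} hx hy := by
    refine ⟨add_mem (add_mem hx.1 (S.smul_mem_sup hA₁_inv hx.2 hy.1)) (S.hStar_mem_sup _),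
      fun q => ?_⟩
    have := A₁.add_mem (hA₁_inv x.g _ (hy.2 q)) (hx.2 q)
    rwa [smul_sub, sub_add_sub_cancel, ← mul_smul] at this
  inv_mem' {x} hx := by
    have h1 : ∀ q, x.g⁻¹ • S.incA j (S.h q) - S.incA j (S.h q) ∈ A₁ := fun q => by
      have := A₁.neg_mem (hA₁_inv x.g⁻¹ _ (hx.2 q))
      rwa [smul_sub, inv_smul_smul, neg_sub] at this
    exact ⟨sub_mem (neg_mem (S.smul_mem_sup hA₁_inv h1 hx.1)) (S.hStar_mem_sup _), h1⟩

/-- An automorphism over `B` fixes `A₀` pointwise and preserves `A₁`, hence preserves both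
conditions. Invariance is all that is claimed: `A₀ + A₁` is a union of translates of `A₁`, with no
reason to be type-definable. -/
theorem invariantOver_trivSubgroup
    (hA₁ : TypeDefinable L (j '' B) (S.ac '' (A₁ : Set (S.AStar j)))) :
    InvariantOver L (j '' B) (S.ec '' (S.trivSubgroup hA₁_inv : Set (S.Ext j))) := by
  rintro σ hσ _ ⟨x, ⟨hx1, hx2⟩, rfl⟩
  obtain ⟨y, hy⟩ := exists_conj S.definable_range_ec hσ x
  have hya : S.ac y.a = σ ∘ S.ac x.a := funext fun i => congrFun hy (Sum.inl i)
  have hyg : S.gc y.g = σ ∘ S.gc x.g := funext fun i => congrFun hy (Sum.inr i)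
  refine ⟨y, ⟨?_, fun q => ?_⟩, hy⟩
  · obtain ⟨b, hb, d, hd, hbd⟩ := AddSubgroup.mem_sup.1 hx1
    obtain ⟨d', hd'⟩ := exists_conj S.definable_range_ac hσ d
    have h1 := S.conj_add hσ (S.conj_A0Star hσ hb) hd'
    rw [hbd, ← hya] at h1
    rw [← S.ac_injective h1]
    exact AddSubgroup.mem_sup.2 ⟨b, hb, d', S.conj_mem hσ hA₁ hd' hd, rfl⟩
  · have h1 := S.conj_A0Star hσ (S.incA_h_mem_A0Star q)
    have h2 := S.conj_add hσ (S.conj_smul hσ hyg h1) (S.conj_neg hσ h1)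
    rw [← sub_eq_add_neg, ← sub_eq_add_neg] at h2
    exact S.conj_mem hσ hA₁ h2 (hx2 q)

/-- The cocycle identity at `(g⁻¹, g, k)`; it shows that this translate of a value of `h*` stays in
`A₀`. -/
theorem smul_hStar_eq (g k : S.GStar j) :
    g⁻¹ • S.hStar j (g, k) = S.hStar j (g⁻¹, g) - S.hStar j (g⁻¹, g * k) := by
  have := S.hStar_cocycle g⁻¹ g k
  rw [inv_mul_cancel, S.hStar_one_left, add_zero] at this
  rw [this, add_sub_cancel_left]

theorem card_quotient_trivSubgroup_lt (hκ : ℵ₀ < κ) (hA₁_bdd : #(S.AStar j ⧸ A₁) < κ) :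
    #(S.Ext j ⧸ S.trivSubgroup hA₁_inv) < κ := by
  have := S.finite_h.to_subtype
  obtain ⟨k, ⟨eqv⟩⟩ := Finite.exists_equiv_fin (Set.range S.h)
  -- The coset of `(a, g)` is determined by the class of `a` and the classes of the translates by
  -- `g` of the finitely many values of `h`.
  refine card_quotient_lt (T := (S.AStar j ⧸ A₁) × (Fin k → S.AStar j ⧸ A₁))
    (fun x => ((x.a : S.AStar j ⧸ A₁), fun i => ((x.g • S.incA j (eqv.symm i).1 :) : S.AStar j ⧸ A₁)))
    ?_ ?_
  · rw [Cardinal.mk_prod, Cardinal.lift_id, Cardinal.lift_id]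
    exact Cardinal.mul_lt_of_lt hκ.le hA₁_bdd (card_fin_arrow_lt hκ hA₁_bdd k)
  · intro x y hxy
    obtain ⟨h1, h2⟩ := Prod.mk.inj hxy
    have h3 : ∀ q, (x⁻¹ * y).g • S.incA j (S.h q) - S.incA j (S.h q) ∈ A₁ := fun q => by
      have h4 := congrFun h2 (eqv ⟨_, q, rfl⟩)
      simp only [Equiv.symm_apply_apply] at h4
      have h5 := hA₁_inv x.g⁻¹ _ (QuotientAddGroup.eq.1 h4)
      rw [smul_add, smul_neg, inv_smul_smul, neg_add_eq_sub, ← mul_smul] at h5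
      exact h5
    refine ⟨?_, h3⟩
    -- Reading off `y = x * (x⁻¹ * y)` and solving gives the first coordinate of `x⁻¹ * y` as an
    -- element of `A₁` minus a translated value of `h*`.
    have h4 : y.a = x.a + x.g • (x⁻¹ * y).a + S.hStar j (x.g, (x⁻¹ * y).g) := by
      rw [← Ext.mul_a, mul_inv_cancel_left]
    have h5 : (x⁻¹ * y).a =
        x.g⁻¹ • (-x.a + y.a) - x.g⁻¹ • S.hStar j (x.g, (x⁻¹ * y).g) := by
      rw [← smul_sub, h4, eq_inv_smul_iff]
      abel
    rw [h5, smul_hStar_eq]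
    exact sub_mem ((le_sup_right : A₁ ≤ S.A0Star j ⊔ A₁) (hA₁_inv _ _ (QuotientAddGroup.eq.1 h1)))
      (sub_mem (S.hStar_mem_sup _) (S.hStar_mem_sup _))

section Splitting

variable {H : Subgroup S.G} {f : H → S.A}
  (hH : B.Definable L (Subtype.val '' (H : Set S.G)))
  (hf : B.Definable L (graph (S.subC H) Subtype.val f)) (hf_one : f 1 = 0)
  (hf_split : ∀ x y : H, S.h (x, y) = f x + (x : S.G) • f y - f (x * y))

theorem definable_sectionGroup : (j '' B).Definable L
    (S.ec '' (S.sectionGroup j hH hf hf_one hf_split : Set (S.Ext j))) := by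
  have h1 : (j '' B).Definable L (graph S.ec S.ac fun x : S.Ext j => -x.a) :=
    definable_graph_comp S.ac_injective S.definable_graph_ext_a S.definable_graph_neg
  exact definable_preimage (pairC_injective S.gc_injective S.ac_injective)
    (definable_graph_pair S.ec_injective S.definable_graph_ext_g h1) (S.definable_graphStar hf)

theorem typeDefinable_map_section (hN : IsMonster L N κ) (hB : B.Finite) {K : Subgroup (S.Ext j)}
    (hK : TypeDefinable L (j '' B) (S.ec '' (K : Set (S.Ext j)))) :
    TypeDefinable L (j '' B) (S.gc '' (((S.sectionGroup j hH hf hf_one hf_split ⊓ K).map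
      (S.extProj j) : Subgroup (S.GStar j)) : Set (S.GStar j))) :=
  (((TypeDefinable.of_definable (S.definable_sectionGroup hH hf hf_one hf_split)).image_inter
    S.ec_injective hK)).image hN (image_small hN.aleph0_lt j hB) S.ec_injective
    S.definable_graph_ext_g

/-- A point of `G*` is moved into `HStar` by one of finitely many representatives and then lifted to
the section; the representative and the class of the lift modulo `K` determine its coset. -/
theorem card_quotient_map_section_lt [H.FiniteIndex] (hκ : ℵ₀ < κ) {K : Subgroup (S.Ext j)}
    (hK : #(S.Ext j ⧸ K) < κ) :
    #(S.GStar j ⧸ (S.sectionGroup j hH hf hf_one hf_split ⊓ K).map (S.extProj j)) < κ := by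
  have : Finite (S.G ⧸ H) := inferInstance
  obtain ⟨k, ⟨eqv⟩⟩ := Finite.exists_equiv_fin (S.G ⧸ H)
  choose r hr using S.exists_mul_mem_HStar hH (j := j)
  have h0 : ∀ x, ∃ y ∈ S.sectionGroup j hH hf hf_one hf_split,
      y.g = S.incG j (r x).out⁻¹ * x := fun x => by
    obtain ⟨a, ha⟩ := (S.mem_HStar_iff hH hf).1 (hr x)
    refine ⟨⟨-a, _⟩, ?_, rfl⟩
    change (_, - -a) ∈ S.graphStar j H f
    rwa [neg_neg]
  choose y hy hyg using h0
  refine card_quotient_lt (T := ULift.{w} (Fin k) × (S.Ext j ⧸ K))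
    (fun x => (⟨eqv (r x)⟩, (y x : S.Ext j ⧸ K))) ?_ fun x x' hxx => ?_
  · rw [Cardinal.mk_prod, Cardinal.lift_id, Cardinal.lift_id]
    exact Cardinal.mul_lt_of_lt hκ.le ((Cardinal.lt_aleph0_of_finite _).trans hκ) hK
  · obtain ⟨h1, h2⟩ := Prod.mk.inj hxx
    have h3 : r x = r x' := eqv.injective (ULift.up_injective h1)
    refine ⟨(y x)⁻¹ * y x',
      Subgroup.mem_inf.2 ⟨mul_mem (inv_mem (hy x)) (hy x'), QuotientGroup.eq.1 h2⟩, ?_⟩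
    change (y x).g⁻¹ * (y x').g = _
    rw [hyg, hyg, h3]
    group

include hH hf_one hf_split in
theorem image00_subset_of_comp000_eq_comp00 [H.FiniteIndex] (hN : IsMonster L N κ) (hB : B.Finite)
    (hf : B.Definable L (graph (S.subC H) Subtype.val f))
    (hA₁ : TypeDefinable L (j '' B) (S.ac '' (A₁ : Set (S.AStar j))))
    (hA₁_bdd : #(S.AStar j ⧸ A₁) < κ) (hA₁_inv : ∀ (g : S.GStar j), ∀ a ∈ A₁, g • a ∈ A₁)
    (h : comp000 L (j '' B) κ (S.ec (j := j)) = comp00 L (j '' B) κ (S.ec (j := j))) :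
    S.image00 j κ A₁ H f ⊆
      ((S.A0Star j).map (QuotientAddGroup.mk' A₁) : Set (S.AStar j ⧸ A₁)) := by
  rintro _ ⟨g, hg, a, ha, rfl⟩
  have h1 : (⟨-a, g⟩ : S.Ext j) ∈ comp00 L (j '' B) κ (S.ec (j := j)) := by
    refine Subgroup.mem_sInf.2 fun K hK => ?_
    obtain ⟨x, ⟨hx1, hx2⟩, rfl⟩ := Subgroup.mem_sInf.1 hg _
      ⟨S.typeDefinable_map_section hH hf hf_one hf_split hN hB hK.1,
        S.card_quotient_map_section_lt hH hf hf_one hf_split hN.aleph0_lt hK.2⟩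
    -- The section has only one point over `g`, so the point of `K` found there is `(-a, g)`.
    have h2 : a = -x.a := S.graphStar_unique hH hf ha hx1
    rw [h2, neg_neg]
    exact hx2
  rw [← h] at h1
  have h2 := Subgroup.mem_sInf.1 h1 (S.trivSubgroup hA₁_inv)
    ⟨S.invariantOver_trivSubgroup hA₁_inv hA₁,
      S.card_quotient_trivSubgroup_lt hA₁_inv hN.aleph0_lt hA₁_bdd⟩
  have h3 : a ∈ S.A0Star j ⊔ A₁ := neg_mem_iff.1 h2.1
  obtain ⟨b, hb, d, hd, rfl⟩ := AddSubgroup.mem_sup.1 h3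
  refine ⟨b, hb, ?_⟩
  exact QuotientAddGroup.eq.2 (by rwa [neg_add_cancel_left])

end Splitting

end CocycleData

/-! ### Divisibility in finitely generated torsion-free groups; general facts on components. -/

theorem eq_zero_of_forall_pow_nsmul {V : Type*} [AddCommGroup V] [Module.Finite ℤ V]
    [IsAddTorsionFree V] {n : ℕ} (hn : 2 ≤ n) {x : V} (h : ∀ k : ℕ, ∃ y, x = n ^ k • y) : x = 0 := by
  have b := Module.Free.chooseBasis ℤ V
  refine b.repr.map_eq_zero_iff.1 (Finsupp.ext fun i => ?_)
  by_contra h0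
  -- The exponent is the size `k` of the nonzero coordinate itself: `n ^ k` would divide `k`,
  -- although `k < n ^ k`.
  obtain ⟨y, hy⟩ := h (b.repr x i).natAbs
  have h1 : b.repr x i = (n : ℤ) ^ (b.repr x i).natAbs * b.repr y i := by
    conv_lhs => rw [hy]
    simp
  have h2 : n ^ (b.repr x i).natAbs ∣ (b.repr x i).natAbs := by
    rw [← Int.natCast_dvd, Nat.cast_pow]
    exact ⟨_, h1⟩
  exact absurd (Nat.le_of_dvd (Int.natAbs_pos.2 h0) h2) (not_le.2 (Nat.lt_pow_self hn))

section Components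

variable {L : FirstOrder.Language.{u, v}} {N : Type w} [L.Structure N] {P : Set N} {κ : Cardinal.{w}}
  {X : Type w} [Group X] {α : Type} {c : X → α → N}

/-- An arbitrary intersection of sets type-definable over `P` is type-definable over `P`, however
many there are; intersecting with the range of `c` keeps all points in `X`. -/
theorem typeDefinable_comp00 (hc : c.Injective) (hX : P.Definable L (Set.range c)) :
    TypeDefinable L P (c '' (comp00 L P κ c : Set X)) := by
  have h1 : c '' (comp00 L P κ c : Set X) = Set.range c ∩
      ⋂ K : {K : Subgroup X | TypeDefinable L P (c '' (K : Set X)) ∧ #(X ⧸ K) < κ},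
        c '' (K : Set X) := by
    ext v
    constructor
    · rintro ⟨x, hx, rfl⟩
      exact ⟨⟨x, rfl⟩, Set.mem_iInter.2 fun K => ⟨x, Subgroup.mem_sInf.1 hx K K.2, rfl⟩⟩
    · rintro ⟨⟨x, rfl⟩, hx⟩
      exact ⟨x, Subgroup.mem_sInf.2 fun K hK =>
        hc.mem_set_image.1 (Set.mem_iInter.1 hx ⟨K, hK⟩), rfl⟩
  rw [h1]
  exact (TypeDefinable.of_definable hX).inter (typeDefinable_iInter fun K => K.2.1)

theorem mem_family_of_inf {K K' : Subgroup X} (hκ : ℵ₀ < κ) (hc : c.Injective)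
    (hK : TypeDefinable L P (c '' (K : Set X)) ∧ #(X ⧸ K) < κ)
    (hK' : TypeDefinable L P (c '' (K' : Set X)) ∧ #(X ⧸ K') < κ) :
    TypeDefinable L P (c '' ((K ⊓ K' : Subgroup X) : Set X)) ∧ #(X ⧸ (K ⊓ K' : Subgroup X)) < κ := by
  refine ⟨hK.1.image_inter hc hK'.1, ?_⟩
  refine card_quotient_lt (T := (X ⧸ K) × (X ⧸ K')) (fun x => (x, x)) ?_ fun x y h => ?_
  · rw [Cardinal.mk_prod, Cardinal.lift_id, Cardinal.lift_id]
    exact Cardinal.mul_lt_of_lt hκ.le hK.2 hK'.2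
  · obtain ⟨h1, h2⟩ := Prod.mk.inj h
    exact ⟨QuotientGroup.eq.1 h1, QuotientGroup.eq.1 h2⟩

end Components

/-! ### The compactness argument on multiples of an element. -/

namespace CocycleData

variable {L : FirstOrder.Language.{u, v}} {M : Type w'} [L.Structure M] {N : Type w} [L.Structure N]
  {B : Set M} (S : CocycleData L M B) {j : M ↪ₑ[L] N} {κ : Cardinal.{w}}
  {A₁ : AddSubgroup (S.AStar j)}

variable (j) in
theorem fg_A0Star : (S.A0Star j).FG := by
  rw [A0Star_eq_closure]
  refine (AddSubgroup.fg_iff _).2 ⟨_, rfl, ?_⟩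
  have : (Set.range fun q => S.incA j (S.h q)) = S.incA j '' Set.range S.h := by
    rw [← Set.range_comp]
    rfl
  rw [this]
  exact S.finite_h.image _

/-- Modulo `A₁`, the group `A₀ + A₁` becomes `A₀/(A₁ ∩ A₀)`, to which `eq_zero_of_forall_pow_nsmul`
applies. -/
theorem mem_of_forall_pow_nsmul
    (htf : IsAddTorsionFree (S.A0Star j ⧸ A₁.addSubgroupOf (S.A0Star j)))
    {n : ℕ} (hn : 2 ≤ n) {x : S.AStar j} (hx : x ∈ S.A0Star j ⊔ A₁)
    (h : ∀ k : ℕ, ∃ y ∈ S.A0Star j ⊔ A₁, x - n ^ k • y ∈ A₁) : x ∈ A₁ := by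
  have : AddGroup.FG (S.A0Star j) := (AddGroup.fg_iff_addSubgroup_fg _).2 (S.fg_A0Star j)
  have : Module.Finite ℤ (S.A0Star j) := Module.Finite.iff_addGroup_fg.2 inferInstance
  have : Module.Finite ℤ (S.A0Star j ⧸ A₁.addSubgroupOf (S.A0Star j)) :=
    Module.Finite.of_surjective
      ((QuotientAddGroup.mk' (A₁.addSubgroupOf (S.A0Star j))).toIntLinearMap)
      (QuotientAddGroup.mk'_surjective _)
  obtain ⟨b, hb, d, hd, rfl⟩ := AddSubgroup.mem_sup.1 hx
  have h0 : ((⟨b, hb⟩ : S.A0Star j) : S.A0Star j ⧸ A₁.addSubgroupOf (S.A0Star j)) = 0 := by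
    refine eq_zero_of_forall_pow_nsmul hn fun k => ?_
    obtain ⟨y, hy, hxy⟩ := h k
    obtain ⟨b', hb', d', hd', rfl⟩ := AddSubgroup.mem_sup.1 hy
    refine ⟨((⟨b', hb'⟩ : S.A0Star j) : S.A0Star j ⧸ A₁.addSubgroupOf (S.A0Star j)), ?_⟩
    rw [← QuotientAddGroup.mk_nsmul]
    refine (QuotientAddGroup.eq.2 ?_).symm
    rw [AddSubgroup.mem_addSubgroupOf]
    change -(n ^ k • b') + b ∈ A₁
    have h2 : -(n ^ k • b') + b = (b + d - n ^ k • (b' + d')) - d + n ^ k • d' := by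
      rw [nsmul_add]
      abel
    rw [h2]
    exact add_mem (sub_mem hxy hd) (nsmul_mem hd' _)
  rw [QuotientAddGroup.eq_zero_iff, AddSubgroup.mem_addSubgroupOf] at h0
  exact add_mem h0 hd

theorem definable_graph_nsmul (n : ℕ) :
    (j '' B).Definable L (graph S.ac S.ac fun a : S.AStar j => n • a) := by
  induction n with
  | zero =>
    simp only [zero_smul]
    exact definable_graph_const S.definable_range_ac S.definable_zero
  | succ n ih =>
    simp only [succ_nsmul]
    exact definable_graph_comp (pairC_injective S.ac_injective S.ac_injective)
      (definable_graph_pair S.ac_injective ih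
        (definable_graph_coord id S.definable_range_ac fun _ => rfl)) S.definable_graph_add

variable (B j) in
/-- The parameters consisting of the images of `B` and the coordinates of the multiples of `a`. -/
def multParams (a : S.AStar j) : Set N := j '' B ∪ ⋃ m : ℕ, Set.range (S.ac (m • a))

/-- The parameter set is countable, and `κ` is uncountable. -/
theorem card_multParams_lt (hN : IsMonster L N κ) (hB : B.Finite) (a : S.AStar j) :
    #(S.multParams B j a) < κ := by
  refine card_union_lt hN (image_small hN.aleph0_lt j hB) (lt_of_le_of_lt ?_ hN.aleph0_lt)
  exact (Set.countable_iUnion fun m => (Set.finite_range _).countable).le_aleph0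

theorem definable_nsmul_singleton (a : S.AStar j) (m : ℕ) :
    (S.multParams B j a).Definable L ({S.ac (m • a)} : Set (Fin S.m → N)) :=
  definable_singleton fun i => Or.inr (Set.mem_iUnion.2 ⟨m, i, rfl⟩)

/-- The point `x` plays the role of the `n`-adic sum of the series `∑ n ^ i • a`: each partial sum
approximates it up to `n ^ k • F`. Such a point exists by saturation. -/
theorem exists_forall_eq_geom_add (hN : IsMonster L N κ) (hB : B.Finite) {F : Set (S.AStar j)}
    (hF : TypeDefinable L (j '' B) (S.ac '' F)) {a : S.AStar j} (ha : ∀ m : ℕ, m • a ∈ F) (n : ℕ) :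
    ∃ x, ∀ k : ℕ, ∃ y ∈ F, (∑ i ∈ Finset.range k, n ^ i) • a + n ^ k • y = x := by
  have hmono : j '' B ⊆ S.multParams B j a := Set.subset_union_left
  have hP := S.card_multParams_lt hN hB a
  refine TypeDefinable.exists_of_finite hN hP
    (U := fun k : ℕ => (fun y => (∑ i ∈ Finset.range k, n ^ i) • a + n ^ k • y) '' F)
    (fun k => ?_) S.ac_injective 0 fun s => ?_
  · refine (hF.mono hmono).image hN hP S.ac_injective ?_
    exact definable_graph_comp (pairC_injective S.ac_injective S.ac_injective)
      (definable_graph_pair S.ac_injective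
        (definable_graph_const (S.definable_range_ac.mono hmono)
          (S.definable_nsmul_singleton a (∑ i ∈ Finset.range k, n ^ i)))
        ((S.definable_graph_nsmul _).mono hmono)) (S.definable_graph_add.mono hmono)
  · obtain ⟨K, hK⟩ := s.exists_nat_subset_range
    -- A long partial sum meets finitely many conditions: its tail beyond `k` is `n ^ k` times a
    -- shorter partial sum, whose multiple of `a` lies in `F`.
    refine ⟨(∑ i ∈ Finset.range K, n ^ i) • a, fun k hk => ?_⟩
    obtain ⟨d, rfl⟩ := Nat.exists_eq_add_of_le (Finset.mem_range.1 (hK hk)).le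
    refine ⟨(∑ i ∈ Finset.range d, n ^ i) • a, ha _, ?_⟩
    change _ • a + n ^ k • _ • a = _
    rw [Finset.sum_range_add, add_nsmul, ← mul_nsmul', Finset.mul_sum]
    simp only [pow_add]

theorem mem_of_forall_nsmul_mem (hN : IsMonster L N κ) (hB : B.Finite)
    (htf : IsAddTorsionFree (S.A0Star j ⧸ A₁.addSubgroupOf (S.A0Star j)))
    {F : Set (S.AStar j)} (hF : TypeDefinable L (j '' B) (S.ac '' F))
    (hFA : F ⊆ (S.A0Star j ⊔ A₁ : AddSubgroup (S.AStar j)))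
    {a : S.AStar j} (ha : ∀ m : ℕ, m • a ∈ F) : a ∈ A₁ := by
  have haA : a ∈ S.A0Star j ⊔ A₁ := by
    have := hFA (ha 1)
    rwa [one_nsmul] at this
  refine S.mem_of_forall_pow_nsmul htf (n := 3) (by norm_num) haA fun r => ?_
  obtain ⟨x, hx⟩ := S.exists_forall_eq_geom_add hN hB hF ha (3 ^ r + 1)
  have hxA : x ∈ S.A0Star j ⊔ A₁ := by
    obtain ⟨y, hy, rfl⟩ := hx 0
    exact add_mem (nsmul_mem haA _) (nsmul_mem (hFA hy) _)
  have h3 : 1 ≤ 3 ^ r := Nat.one_le_pow _ _ (by norm_num)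
  -- With `n = 3 ^ r + 1`, the geometric sum formula gives `(n - 1) • x + a = n ^ k • (a + (n - 1) •
  -- y)` for every `k`, so this element is divisible by all powers of `n`.
  have key : 3 ^ r • x + a ∈ A₁ := by
    refine S.mem_of_forall_pow_nsmul htf (n := 3 ^ r + 1) (by omega)
      (add_mem (nsmul_mem hxA _) haA) fun k => ?_
    obtain ⟨y, hy, rfl⟩ := hx k
    refine ⟨a + 3 ^ r • y, add_mem haA (nsmul_mem (hFA hy) _), ?_⟩
    have h4 : 3 ^ r * (∑ i ∈ Finset.range k, (3 ^ r + 1) ^ i) + 1 = (3 ^ r + 1) ^ k := by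
      clear hx hxA
      induction k with
      | zero => simp
      | succ k ih =>
        rw [Finset.sum_range_succ, mul_add, add_right_comm, ih, pow_succ]
        ring
    have h5 : 3 ^ r • ((∑ i ∈ Finset.range k, (3 ^ r + 1) ^ i) • a + (3 ^ r + 1) ^ k • y) + a =
        (3 ^ r + 1) ^ k • (a + 3 ^ r • y) := by
      rw [← h4]
      module
    rw [h5, sub_self]
    exact zero_mem _
  -- Modulo `A₁`, `a` equals `3 ^ r • (-x)`, where `x` depends on `r`; since `r` is arbitrary, `a`
  -- is divisible by every power of `3`.
  refine ⟨-x, neg_mem hxA, ?_⟩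
  rwa [smul_neg, sub_neg_eq_add, add_comm]

section Image

variable {H : Subgroup S.G} {f : H → S.A}

variable (j κ A₁ f) in
/-- The preimage in `A*` of `image00`. -/
def preimage00 : Set (S.AStar j) := {a | (a : S.AStar j ⧸ A₁) ∈ S.image00 j κ A₁ H f}

/-- This set is the sum of `A₁` and the image under `f*` of the `00`-component, both type-definable,
and saturation makes images of type-definable sets type-definable. -/
theorem typeDefinable_preimage00 (hN : IsMonster L N κ) (hB : B.Finite)
    (hf : B.Definable L (graph (S.subC H) Subtype.val f))
    (hA₁ : TypeDefinable L (j '' B) (S.ac '' (A₁ : Set (S.AStar j)))) :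
    TypeDefinable L (j '' B) (S.ac '' S.preimage00 j κ A₁ f) := by
  have hP := image_small hN.aleph0_lt j hB
  have i := pairC_injective (S.gc_injective (j := j)) (S.ac_injective (j := j))
  have h1 : S.preimage00 j κ A₁ f = (fun p : S.AStar j × S.AStar j => p.1 + p.2) ''
      ((Prod.snd '' (S.graphStar j H f ∩
        (comp00 L (j '' B) κ (S.gc (j := j)) : Set (S.GStar j)) ×ˢ Set.univ)) ×ˢ A₁) := by
    ext a
    constructor
    · rintro ⟨g, hg, b, hb, h⟩
      refine ⟨(b, -b + a), ⟨⟨(g, b), ⟨hb, hg, trivial⟩, rfl⟩, QuotientAddGroup.eq.1 h.symm⟩, ?_⟩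
      exact add_neg_cancel_left b a
    · rintro ⟨⟨b, d⟩, ⟨⟨⟨g, b'⟩, ⟨hb, hg, -⟩, rfl⟩, hd⟩, rfl⟩
      refine ⟨g, hg, b', hb, (QuotientAddGroup.eq.2 ?_).symm⟩
      change -b' + (b' + d) ∈ A₁
      rwa [neg_add_cancel_left]
  rw [h1]
  refine TypeDefinable.image hN hP (pairC_injective S.ac_injective S.ac_injective)
    S.definable_graph_add (TypeDefinable.prod (TypeDefinable.image hN hP i ?_ ?_) hA₁)
  · exact definable_graph_coord Sum.inr
      (definable_range_pairC S.definable_range_gc S.definable_range_ac) fun _ => rfl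
  · refine (TypeDefinable.of_definable (S.definable_graphStar hf)).image_inter i
      ((typeDefinable_comp00 S.gc_injective S.definable_range_gc).prod ?_)
    rw [Set.image_univ]
    exact TypeDefinable.of_definable S.definable_range_ac

theorem not_image00_subset (hN : IsMonster L N κ) (hB : B.Finite)
    (htf : IsAddTorsionFree (S.A0Star j ⧸ A₁.addSubgroupOf (S.A0Star j)))
    (hf : B.Definable L (graph (S.subC H) Subtype.val f))
    (hA₁ : TypeDefinable L (j '' B) (S.ac '' (A₁ : Set (S.AStar j))))
    {a : S.AStar j} (ha : a ∉ A₁) (h : ∀ m : ℕ, ((m • a :) : S.AStar j ⧸ A₁) ∈ S.image00 j κ A₁ H f) :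
    ¬ S.image00 j κ A₁ H f ⊆
      ((S.A0Star j).map (QuotientAddGroup.mk' A₁) : Set (S.AStar j ⧸ A₁)) := by
  refine fun hsub => ha (S.mem_of_forall_nsmul_mem hN hB htf
    (S.typeDefinable_preimage00 hN hB hf hA₁) (fun b hb => ?_) h)
  obtain ⟨d, hd, hdb⟩ := hsub hb
  exact AddSubgroup.mem_sup.2 ⟨d, hd, -d + b, QuotientAddGroup.eq.1 hdb, add_neg_cancel_left d b⟩

theorem not_image00_subset_of_subgroup (hN : IsMonster L N κ) (hB : B.Finite)
    (htf : IsAddTorsionFree (S.A0Star j ⧸ A₁.addSubgroupOf (S.A0Star j)))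
    (hf : B.Definable L (graph (S.subC H) Subtype.val f))
    (hA₁ : TypeDefinable L (j '' B) (S.ac '' (A₁ : Set (S.AStar j))))
    {K : AddSubgroup (S.AStar j ⧸ A₁)} (hK : K ≠ ⊥)
    (hKs : (K : Set (S.AStar j ⧸ A₁)) ⊆ S.image00 j κ A₁ H f) :
    ¬ S.image00 j κ A₁ H f ⊆
      ((S.A0Star j).map (QuotientAddGroup.mk' A₁) : Set (S.AStar j ⧸ A₁)) := by
  obtain ⟨⟨q, hq⟩, hne⟩ := (AddSubgroup.ne_bot_iff_exists_ne_zero (H := K)).1 hK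
  have hq0 : q ≠ 0 := fun h => hne (Subtype.ext h)
  obtain ⟨a, rfl⟩ := QuotientAddGroup.mk_surjective q
  exact S.not_image00_subset hN hB htf hf hA₁ (fun h => hq0 ((QuotientAddGroup.eq_zero_iff a).2 h))
    fun m => hKs (nsmul_mem hq m)

end Image

end CocycleData

/-! ### Thick definable sets around type-definable subgroups of bounded index. -/

section Thick

variable {L : FirstOrder.Language.{u, v}} {N : Type w} [L.Structure N] {P : Set N} {κ : Cardinal.{w}}
  {X : Type w} [Group X] {α : Type} [Finite α] {c : X → α → N} (hN : IsMonster L N κ) (hP : #P < κ)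
  (hc : c.Injective) (hX : P.Definable L (Set.range c))
  (hmul : P.Definable L (graph (pairC c c) c fun p : X × X => p.1 * p.2)) {K : Subgroup X}
  (hK : TypeDefinable L P (c '' (K : Set X)))

include hN hP hc hX hmul hK in
-- Otherwise every finite part of the definition of `K` admits a pair with quotient outside `D`, and
-- saturation gives such a pair inside the subgroup `K`.
theorem exists_definable_inv_mul_mem {D : Set X} (hD : P.Definable L (c '' D)) (hKD : (K : Set X) ⊆ D) :
    ∃ D₁ : Set X, P.Definable L (c '' D₁) ∧ (K : Set X) ⊆ D₁ ∧
      ∀ x ∈ D₁, ∀ y ∈ D₁, x⁻¹ * y ∈ D := by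
  classical
  by_contra! h
  have hinj := pairC_injective hc hc
  have hXX := definable_range_pairC hX hX
  obtain ⟨F, hF, hKF⟩ := hK
  let D' : Finset {E // E ∈ F} → Set X := fun s => c ⁻¹' ⋂ E ∈ s, E.1
  have hD' : ∀ s, P.Definable L (c '' D' s) := fun s =>
    definable_image_preimage_range hX (Set.definable_biInter_finset (fun E : {E // E ∈ F} => hF E.1 E.2) s)
  have hmem : ∀ s x, x ∈ D' s ↔ ∀ E ∈ s, c x ∈ E.1 := fun s x => by simp [D']
  have hdiv : P.Definable L (pairC c c '' {p : X × X | p.1⁻¹ * p.2 ∉ D}) := by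
    -- Parametrising by `(x, z) ↦ (x, x * z)` avoids inversion and needs only the graph of
    -- multiplication.
    have h1 : {p : X × X | p.1⁻¹ * p.2 ∉ D} =
        (fun p : X × X => (p.1, p.1 * p.2)) '' (Set.univ ×ˢ Dᶜ) := by
      ext p
      constructor
      · exact fun hp => ⟨(p.1, p.1⁻¹ * p.2), ⟨trivial, hp⟩, by simp⟩
      · rintro ⟨q, ⟨-, hq⟩, rfl⟩
        simpa using hq
    rw [h1]
    refine definable_image hinj (definable_graph_pair hinj
      (definable_graph_coord Sum.inl hXX fun _ => rfl) hmul) ?_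
    rw [image_pairC_prod, Set.image_univ]
    exact (hX.preimage_comp _).inter ((definable_image_compl hc hX hD).preimage_comp _)
  obtain ⟨⟨x, y⟩, hxy⟩ := TypeDefinable.exists_of_finite hN hP
    (U := fun s => (D' s ×ˢ D' s) ∩ {p : X × X | p.1⁻¹ * p.2 ∉ D})
    (fun s => (((TypeDefinable.of_definable (hD' s)).prod (.of_definable (hD' s))).image_inter hinj
      (.of_definable hdiv))) hinj ∅ (fun t => by
      -- The union of the finitely many finite parts in `t` handles all of them at once.
      obtain ⟨x, hx, y, hy, hxy⟩ := h (D' (t.sup id)) (hD' _) (fun z hz => by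
        rw [hmem]
        intro E _
        have h1 : c z ∈ ⋂₀ F := hKF ▸ ⟨z, hz, rfl⟩
        exact h1 E.1 E.2)
      rw [hmem] at hx hy
      refine ⟨(x, y), fun s hs => ⟨⟨?_, ?_⟩, hxy⟩⟩ <;> rw [hmem] <;> intro E hE
      · exact hx E (Finset.mem_sup.2 ⟨s, hs, hE⟩)
      · exact hy E (Finset.mem_sup.2 ⟨s, hs, hE⟩))
  have hK' : ∀ z, (∀ s, z ∈ D' s) → z ∈ K := fun z hz => by
    have h1 : c z ∈ c '' (K : Set X) := by
      rw [hKF]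
      exact fun E hE => (hmem {⟨E, hE⟩} z).1 (hz _) _ (Finset.mem_singleton_self _)
    exact hc.mem_set_image.1 h1
  exact (hxy ∅).2 (hKD (K.mul_mem (K.inv_mem (hK' x fun s => (hxy s).1.1)) (hK' y fun s => (hxy s).1.2)))

include hN hP hc hX hmul in
-- A point outside all finite unions of translates would, by saturation, yield a point outside every
-- translate, although it belongs to some coset of `K ⊆ D`. The coset representatives form a bounded
-- set of new parameters.
theorem exists_finset_cover (hKb : #(X ⧸ K) < κ) {D : Set X} (hD : P.Definable L (c '' D))
    (hKD : (K : Set X) ⊆ D) : ∃ s : Finset (X ⧸ K), ∀ x, ∃ q ∈ s, q.out⁻¹ * x ∈ D := by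
  by_contra! h
  let R : Set N := Set.range fun p : (X ⧸ K) × ULift.{w} α => c p.1.out p.2.down
  have hR : #R < κ := by
    refine mk_range_le.trans_lt ?_
    rw [Cardinal.mk_prod, Cardinal.lift_id, Cardinal.lift_id]
    exact Cardinal.mul_lt_of_lt hN.aleph0_lt.le hKb
      ((Cardinal.lt_aleph0_of_finite _).trans hN.aleph0_lt)
  have hmono : P ⊆ P ∪ R := Set.subset_union_left
  obtain ⟨x, hx⟩ := TypeDefinable.exists_of_finite hN (card_union_lt hN hP hR)
    (U := fun q : X ⧸ K => {x | q.out⁻¹ * x ∉ D}) (fun q => .of_definable (by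
      have h1 : {x | q.out⁻¹ * x ∉ D} = (fun z => q.out * z) '' Dᶜ := by
        ext x
        constructor
        · exact fun hx => ⟨q.out⁻¹ * x, hx, mul_inv_cancel_left _ _⟩
        · rintro ⟨z, hz, rfl⟩
          rw [Set.mem_ofPred_eq, inv_mul_cancel_left]
          exact hz
      rw [h1]
      refine definable_image hc ?_ ((definable_image_compl hc hX hD).mono hmono)
      exact definable_graph_comp (pairC_injective hc hc) (definable_graph_pair hc
        (definable_graph_const (hX.mono hmono)
          (definable_singleton fun i => Or.inr ⟨(q, ULift.up i), rfl⟩))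
        (definable_graph_coord id (hX.mono hmono) fun _ => rfl)) (hmul.mono hmono))) hc
    ((1 : X) : X ⧸ K) h
  exact hx (x : X ⧸ K) (hKD (QuotientGroup.eq.1 (QuotientGroup.out_eq' (x : X ⧸ K))))

include hN hP hc hX hmul hK in
theorem exists_thick_subset (hKb : #(X ⧸ K) < κ) {D : Set X} (hD : P.Definable L (c '' D))
    (hKD : (K : Set X) ⊆ D) : ∃ T ⊆ D, P.Definable L (c '' T) ∧ IsThick T := by
  obtain ⟨D₁, hD₁, hKD₁, hdiv⟩ := exists_definable_inv_mul_mem hN hP hc hX hmul hK hD hKD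
  obtain ⟨s, hs⟩ := exists_finset_cover hN hP hc hX hmul hKb hD₁ hKD₁
  have hinj := pairC_injective hc hc
  have hXX := definable_range_pairC hX hX
  -- This is `D₁⁻¹ D₁`, written through multiplication alone. It is thick by pigeonhole: two of
  -- `s.card + 1` elements fall in the same translate of `D₁`.
  let T : Set X := Prod.snd '' ((Prod.fst ⁻¹' D₁) ∩ ((fun p : X × X => p.1 * p.2) ⁻¹' D₁))
  have hT : ∀ x ∈ D₁, ∀ y ∈ D₁, x⁻¹ * y ∈ T := fun x hx y hy =>
    ⟨(x, x⁻¹ * y), ⟨hx, by simpa using hy⟩, rfl⟩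
  refine ⟨T, ?_, ?_, ?_, s.card + 1, fun g => ?_⟩
  · rintro _ ⟨p, ⟨h1, h2⟩, rfl⟩
    have := hdiv _ h1 _ h2
    rwa [inv_mul_cancel_left] at this
  · refine definable_image hinj (definable_graph_coord Sum.inr hXX fun _ => rfl)
      (definable_image_inter hinj (definable_preimage hc ?_ hD₁) (definable_preimage hc hmul hD₁))
    exact definable_graph_coord Sum.inl hXX fun _ => rfl
  · have key : ∀ z ∈ T, z⁻¹ ∈ T := by
      rintro _ ⟨p, ⟨h1, h2⟩, rfl⟩
      exact ⟨(p.1 * p.2, p.2⁻¹), ⟨h2, by simpa using h1⟩, rfl⟩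
    ext z
    exact ⟨fun hz => inv_inv z ▸ key _ hz, fun hz => key z hz⟩
  · choose q hq hqg using fun i => hs (g i)
    obtain ⟨i, -, i', -, hne, hii⟩ := Finset.exists_ne_map_eq_of_card_lt_of_maps_to
      (s := Finset.univ) (t := s) (f := q) (by simp) (fun i _ => hq i)
    have key : ∀ a b, q a = q b → (g a)⁻¹ * g b ∈ T := fun a b hab => by
      have := hT _ (hqg a) _ (hqg b)
      rw [hab] at this
      simpa [mul_assoc] using this
    rcases lt_or_gt_of_ne hne with h | h
    · exact ⟨i, i', h, key _ _ hii⟩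
    · exact ⟨i', i, h, key _ _ hii.symm⟩

end Thick

/-! ### Descent to `G` and the condition on thick sets. -/

namespace CocycleData

variable {L : FirstOrder.Language.{u, v}} {M : Type w'} [L.Structure M] {N : Type w} [L.Structure N]
  {B : Set M} (S : CocycleData L M B) {j : M ↪ₑ[L] N} {κ : Cardinal.{w}}
  {A₁ : AddSubgroup (S.AStar j)}

variable (j) in
/-- The inclusion `G → G*` as a homomorphism. -/
noncomputable def incGHom : S.G →* S.GStar j :=
  MonoidHom.mk' (S.incG j) fun a b => by
    have k : Linked j (Set.range (Subtype.val : S.G → _)) (Set.range (S.gc (j := j))) := S.linked_G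
    exact linked_map_unique S.gc_injective S.gc_injective
      (linked_const k (a * b) (S.incG j (a * b)) fun _ => rfl)
      (S.linked_mulStar Subtype.val_injective S.gc_injective
        (linked_const k a (S.incG j a) fun _ => rfl)
        (linked_const k b (S.incG j b) fun _ => rfl)) (fun _ => rfl) (S.incG j 1)

theorem definable_preimage_incG {T : Set (S.GStar j)} (hT : (j '' B).Definable L (S.gc '' T)) :
    B.Definable L (Subtype.val '' (S.incGHom j ⁻¹' T)) := by
  have h1 : (Subtype.val '' (S.incGHom j ⁻¹' T) : Set (Fin S.n → M)) =
      {v | (fun i => j (v i)) ∈ S.gc '' T} := by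
    ext v
    constructor
    · rintro ⟨x, hx, rfl⟩
      exact ⟨_, hx, rfl⟩
    · rintro ⟨t, ht, htv⟩
      have h2 : (fun i => j (v i)) ∈ interp j S.G := htv ▸ t.2
      have h3 := (mem_interp (linked_interp S.definable_G)).1 h2
      refine ⟨⟨v, h3⟩, ?_, rfl⟩
      have h4 : S.incGHom j ⟨v, h3⟩ = t := S.gc_injective htv.symm
      rw [Set.mem_preimage, h4]
      exact ht
  rw [h1]
  exact definable_restrict hT

theorem isThick_preimage_incG {T : Set (S.GStar j)} (hT : IsThick T) :
    IsThick (S.incGHom j ⁻¹' T) := by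
  obtain ⟨h1, k, hk⟩ := hT
  refine ⟨?_, k, fun g => ?_⟩
  · ext x
    rw [Set.mem_inv, Set.mem_preimage, Set.mem_preimage, map_inv, ← Set.mem_inv, h1]
  · obtain ⟨p, q, hpq, h⟩ := hk fun i => S.incGHom j (g i)
    exact ⟨p, q, hpq, by rwa [Set.mem_preimage, map_mul, map_inv]⟩

theorem definable_graph_pow_succ (n : ℕ) :
    (j '' B).Definable L (graph S.gc S.gc fun g : S.GStar j => g ^ (n + 1)) := by
  have hid : (j '' B).Definable L (graph S.gc S.gc fun g : S.GStar j => g) :=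
    definable_graph_coord id S.definable_range_gc fun _ => rfl
  induction n with
  | zero => simpa using hid
  | succ n ih =>
    simp only [pow_succ _ (n + 1)]
    exact definable_graph_comp (pairC_injective S.gc_injective S.gc_injective)
      (definable_graph_pair S.gc_injective ih hid) S.definable_graph_mul

variable {H : Subgroup S.G} {f : H → S.A}

/-- Saturation applied to membership in the `00`-component together with all the equations on
powers. The individual subgroups of bounded index, closed under finite intersections, suffice; the
index of the component itself plays no role. -/
theorem exists_mem_comp00_graphStar_pow (hN : IsMonster L N κ) (hB : B.Finite)
    (hf : B.Definable L (graph (S.subC H) Subtype.val f)) (hf_one : f 1 = 0) {a : S.A}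
    (h : ∀ P : Set S.G, B.Definable L (Subtype.val '' P) → IsThick P →
      ∃ g : H, (g : S.G) ∈ P ∧ ∀ n : ℤ, f (g ^ n) = n • a) :
    ∃ g ∈ comp00 L (j '' B) κ (S.gc (j := j)),
      ∀ m : ℕ, (g ^ m, m • S.incA j a) ∈ S.graphStar j H f := by
  classical
  have hP := image_small hN.aleph0_lt j hB
  let p : Subgroup (S.GStar j) → Prop := fun K =>
    TypeDefinable L (j '' B) (S.gc '' (K : Set (S.GStar j))) ∧ #(S.GStar j ⧸ K) < κ
  have hp_top : p ⊤ := by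
    refine ⟨?_, ?_⟩
    · rw [Subgroup.coe_top, Set.image_univ]
      exact .of_definable S.definable_range_gc
    · exact (Cardinal.lt_aleph0_of_finite _).trans hN.aleph0_lt
  -- Each admissible `K` is the intersection of definable sets of this kind, so lying in all of them
  -- amounts to lying in the component.
  let ι := {E : Set (Fin S.n → N) // (j '' B).Definable L E ∧ ∃ K, p K ∧ S.gc '' (K : Set (S.GStar j)) ⊆ E}
  have hfin : ∀ s : Finset ι, ∃ K, p K ∧ ∀ E ∈ s, S.gc '' (K : Set (S.GStar j)) ⊆ E.1 := fun s => by
    induction s using Finset.induction_on with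
    | empty => exact ⟨⊤, hp_top, by simp⟩
    | insert E s _ ih =>
      obtain ⟨K, hK, hKs⟩ := ih
      obtain ⟨K', hK', hKE⟩ := E.2.2
      refine ⟨K' ⊓ K, mem_family_of_inf hN.aleph0_lt S.gc_injective hK' hK, fun E' hE' => ?_⟩
      rcases Finset.mem_insert.1 hE' with rfl | hE'
      · exact (Set.image_mono (SetLike.coe_subset_coe.2 inf_le_left)).trans hKE
      · exact (Set.image_mono (SetLike.coe_subset_coe.2 inf_le_right)).trans (hKs E' hE')
  let b := S.incA j a
  have hmono : j '' B ⊆ S.multParams B j b := Set.subset_union_left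
  -- Only positive exponents are imposed; exponent zero is covered by `f 1 = 0`.
  let C : ℕ → Set (S.GStar j) := fun m => (fun g => (g ^ (m + 1), (m + 1) • b)) ⁻¹' S.graphStar j H f
  have hC : ∀ m, (S.multParams B j b).Definable L (S.gc '' C m) := fun m =>
    definable_preimage (pairC_injective S.gc_injective S.ac_injective)
      (definable_graph_pair S.gc_injective ((S.definable_graph_pow_succ m).mono hmono)
        (definable_graph_const (S.definable_range_gc.mono hmono) (S.definable_nsmul_singleton b (m + 1))))
      ((S.definable_graphStar hf).mono hmono)
  obtain ⟨x, hx⟩ := hN.exists_of_finite (S.card_multParams_lt hN hB b)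
    (Sum.elim (fun E : ι => E.1) fun m => S.gc '' C m)
    (by rintro (E | m); exacts [E.2.1.mono hmono, hC m]) (fun s => by
      obtain ⟨K, hK, hKs⟩ := hfin (s.toLeft)
      obtain ⟨T, hTD, hT, hTt⟩ := exists_thick_subset hN hP S.gc_injective S.definable_range_gc
        S.definable_graph_mul hK.1 hK.2 (D := S.gc ⁻¹' ⋂ E ∈ s.toLeft, E.1)
        (definable_image_preimage_range S.definable_range_gc
          (Set.definable_biInter_finset (fun E : ι => E.2.1) _))
        (fun z hz => by
          simp only [Set.mem_preimage, Set.mem_iInter]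
          exact fun E hE => hKs E hE ⟨z, hz, rfl⟩)
      -- The hypothesis on `G` realises the finite fragment by a point of `G`, with all equations on
      -- powers at once.
      obtain ⟨g, hgT, hg⟩ := h _ (S.definable_preimage_incG hT) (S.isThick_preimage_incG hTt)
      refine ⟨S.gc (S.incG j g), ?_⟩
      rintro (E | m) hE
      · have h1 := hTD hgT
        simp only [Set.mem_preimage, Set.mem_iInter] at h1
        exact h1 E (Finset.mem_toLeft.2 hE)
      · refine ⟨S.incG j g, ?_, rfl⟩
        have h1 := S.incG_incA_mem_graphStar hf (j := j) (g ^ (m + 1))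
        have h2 := hg (m + 1 : ℕ)
        rw [zpow_natCast, natCast_zsmul] at h2
        rw [h2, map_nsmul] at h1
        have h3 : S.incG j ((g ^ (m + 1) : H) : S.G) = S.incG j g ^ (m + 1) :=
          map_pow (S.incGHom j) (g : S.G) (m + 1)
        rw [h3] at h1
        exact h1)
  -- Any of the sets `C m` shows that the tuple found is an element of `G*`.
  obtain ⟨g, -, rfl⟩ := hx (Sum.inr 0)
  refine ⟨g, Subgroup.mem_sInf.2 fun K hK => ?_, fun m => ?_⟩
  · obtain ⟨F, hF, hKF⟩ := id hK.1
    refine (S.gc_injective.mem_set_image (s := (K : Set (S.GStar j)))).1 ?_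
    rw [hKF]
    refine fun E hE => hx (Sum.inl ⟨E, hF E hE, K, hK, ?_⟩)
    rw [hKF]
    exact Set.sInter_subset_of_mem hE
  · cases m with
    | zero =>
      rw [pow_zero, zero_smul]
      exact S.graphStar_one hf hf_one
    | succ m => exact (S.gc_injective.mem_set_image (s := C m)).1 (hx (Sum.inr m))

end CocycleData

end ConnComp

theorem mainTheorem3 {L : FirstOrder.Language.{u, v}} {M : Type w'} [L.Structure M] {N : Type w}
    [L.Structure N] (B : Set M) (hB : B.Finite) (S : ConnComp.CocycleData L M B)
    (κ : Cardinal.{w}) (hN : ConnComp.IsMonster L N κ) (j : M ↪ₑ[L] N)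
    (A₁ : AddSubgroup (S.AStar j))
    (hA₁ : ConnComp.TypeDefinable L (j '' B) (S.ac '' (A₁ : Set (S.AStar j))))
    (hA₁_bdd : #(S.AStar j ⧸ A₁) < κ)
    (hA₁_inv : ∀ (g : S.GStar j), ∀ a ∈ A₁, g • a ∈ A₁)
    (H : Subgroup S.G) (hH : B.Definable L (Subtype.val '' (H : Set S.G))) (hH_fin : H.FiniteIndex)
    (f : H → S.A) (hf : B.Definable L (ConnComp.graph (S.subC H) Subtype.val f))
    (hf_one : f 1 = 0)
    (hf_split : ∀ x y : H, S.h (x, y) = f x + (x : S.G) • f y - f (x * y))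
    (htf : IsAddTorsionFree (S.A0Star j ⧸ A₁.addSubgroupOf (S.A0Star j))) :
    (¬ S.image00 j κ A₁ H f ⊆ ((S.A0Star j).map (QuotientAddGroup.mk' A₁) : Set (S.AStar j ⧸ A₁)) →
      ConnComp.comp000 L (j '' B) κ (S.ec (j := j)) ≠ ConnComp.comp00 L (j '' B) κ (S.ec (j := j))) ∧
    ((∃ K : AddSubgroup (S.AStar j ⧸ A₁), K ≠ ⊥ ∧ (K : Set (S.AStar j ⧸ A₁)) ⊆ S.image00 j κ A₁ H f) ∨
      (∃ a : S.A, S.incA j a ∉ A₁ ∧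
        ∀ P : Set S.G, B.Definable L (Subtype.val '' P) → ConnComp.IsThick P →
          ∃ g : H, (g : S.G) ∈ P ∧ ∀ n : ℤ, f (g ^ n) = n • a) →
      ¬ S.image00 j κ A₁ H f ⊆
        ((S.A0Star j).map (QuotientAddGroup.mk' A₁) : Set (S.AStar j ⧸ A₁))) := by
  refine ⟨fun h h' => h (S.image00_subset_of_comp000_eq_comp00 hH hf_one hf_split hN hB hf hA₁
    hA₁_bdd hA₁_inv h'), ?_⟩
  rintro (⟨K, hK, hKs⟩ | ⟨a, ha, h⟩)
  · exact S.not_image00_subset_of_subgroup hN hB htf hf hA₁ hK hKs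
  · obtain ⟨g, hg, hgm⟩ := S.exists_mem_comp00_graphStar_pow hN hB hf hf_one h
    exact S.not_image00_subset hN hB htf hf hA₁ ha fun m => ⟨g ^ m, pow_mem hg m, _, hgm m, rfl⟩
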